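/- Let $\xi$ be a random variable with values in $\{0,1,2,\dots\}$ such that $\mathbb{E}\,\xi=1$ and $0<\operatorname{Var}\xi<\infty$. Let $\mathcal{T}$ be the Galton--Watson tree with offspring distribution $\xi$, that is, the random rooted family tree, started from a single root, in which the numbers of children of the individuals are independent copies of $\xi$. For every $n\ge 1$ with $\mathbb{P}(|\mathcal{T}|=n)>0$, where $|\mathcal T|$ is the number of vertices, let $T_n$ be $\mathcal{T}$ conditioned on $|\mathcal{T}|=n$. For vertices $v,w$ of a rooted tree $\tau$, let $v\wedge w$ be their last common ancestor (the common ancestor farthest from the root, where every vertex counts as an ancestor of itself), and let $d$ be the graph distance in $\tau$. For integers $\ell,m\ge 0$ let $$Y_{\ell,m}(\tau)=\#\{(v,w): v,w\in\tau,\ d(v,v\wedge w)=\ell,\ d(w,v\wedge w)=m\},$$ the number of such ordered pairs of vertices of $\tau$. Then there exists a constant $C>0$, depending only on the distribution of $\xi$, such that $$\mathbb{E}\,Y_{\ell,m}(T_n)\le C\,n$$ for all $\ell,m\ge 0$ and all $n\ge 1$ with $\mathbb{P}(|\mathcal{T}|=n)>0$. -/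

import Mathlib

open MeasureTheory ProbabilityTheory
open scoped ENNReal NNReal

namespace GaltonWatson

/-- The critical offspring distributions with finite, nonzero variance:
`E ξ = 1` and `0 < Var ξ < ∞`, where `ν` is the law of `ξ` on `ℕ`. -/
structure IsCriticalOffspring (ν : Measure ℕ) : Prop where
  memLp_two : MemLp (fun k : ℕ => (k : ℝ)) 2 ν
  mean_eq_one : ∫ k : ℕ, (k : ℝ) ∂ν = 1
  variance_pos : 0 < Var[fun k : ℕ => (k : ℝ); ν]

/-- The family tree of a population started by one individual. Individuals are named by
Ulam-Harris words: the root is `[]` and the children of `v` are `v ++ [0], v ++ [1], …`.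
The potential individual `v` has `ξ v` children, namely `v ++ [i]` for `i < ξ v`; so a word is an
individual of the tree iff each of its letters is an admissible birth rank. -/
def familyTree (ξ : List ℕ → ℕ) : Set (List ℕ) :=
  {u | ∀ (v : List ℕ) (i : ℕ), v ++ [i] <+: u → i < ξ v}

/-- The law of the offspring numbers of a Galton-Watson process with offspring law `ν`:
the offspring numbers of all potential individuals are i.i.d. with law `ν`. Under this law, the
random set `familyTree ξ` is the (unconditioned) Galton-Watson tree. -/
noncomputable def gwMeasure (ν : Measure ℕ) [IsProbabilityMeasure ν] :
    Measure (List ℕ → ℕ) :=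
  Measure.infinitePi (fun _ : List ℕ => ν)

/-- The event that the family tree has exactly `n` vertices. -/
def sizeEvent (n : ℕ) : Set (List ℕ → ℕ) :=
  {ξ | (familyTree ξ).encard = n}

/-- The law of the offspring numbers conditioned on the family tree having `n` vertices. Under
this law, `familyTree ξ` is the conditioned Galton-Watson tree with `n` vertices. -/
noncomputable def condGWMeasure (ν : Measure ℕ) [IsProbabilityMeasure ν] (n : ℕ) :
    Measure (List ℕ → ℕ) :=
  cond (gwMeasure ν) (sizeEvent n)

/-- A set `τ` of words as a graph: the edges join each vertex of `τ` to its children in `τ`. -/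
def treeGraph (τ : Set (List ℕ)) : SimpleGraph (List ℕ) where
  Adj v w := v ∈ τ ∧ w ∈ τ ∧ ∃ i : ℕ, w = v ++ [i] ∨ v = w ++ [i]
  symm := ⟨fun _ _ ⟨hv, hw, i, h⟩ => ⟨hw, hv, i, h.symm⟩⟩
  loopless := ⟨fun v ⟨_, _, i, h⟩ => by simp at h⟩

/-- The last common ancestor `v ∧ w`, that is, the longest common prefix of the two words. -/
def lastCommonAncestor : List ℕ → List ℕ → List ℕ
  | a :: v, b :: w => if a = b then a :: lastCommonAncestor v w else []
  | _, _ => []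

/-- `Y_{ℓ,m}(τ)`: the number of ordered pairs `(v, w)` of vertices of `τ` with
`d(v, v ∧ w) = ℓ` and `d(w, v ∧ w) = m`, where `d` is the graph distance in `τ`. -/
noncomputable def pairCount (ℓ m : ℕ) (τ : Set (List ℕ)) : ℕ∞ :=
  {p : List ℕ × List ℕ | p.1 ∈ τ ∧ p.2 ∈ τ ∧
    (treeGraph τ).dist p.1 (lastCommonAncestor p.1 p.2) = ℓ ∧
    (treeGraph τ).dist p.2 (lastCommonAncestor p.1 p.2) = m}.encard

end GaltonWatson

/-! Let `G` be the generating function of the offspring law and `T` that of the total size, so `T =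
X G(T)` (`treeSeries_eq`). Splitting the pairs at the root gives a linear equation for the series
with coefficients `E[Y; |𝒯| = n]`. Its solution is `F / (1 - X G'(T))`, where `F` counts the pairs
whose last common ancestor is the root (`sizeSeries_numPairs`). Such a pair spans two paths from the
root. Hence `F = X^(ℓ+m-1) T² G''(T) G'(T)^(ℓ+m-2)` if `ℓ, m ≥ 1`; if one of them vanishes and `h`
is the other, `F = X^h T G'(T)^h`. Lagrange inversion (`coeff_comp_mul_geom`) absorbs the
denominator `1 - X G'(T)` and gives `E[Y; |𝒯| = n] = [x^(n-r)] A G'^s G^(n-r)`, with `A = X` or `A =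
X² G''` and `r ≤ s + 1` (`coeff_sizeSeries_numPairs`). For `ℓ = m = 0` this reads `n P(|𝒯| = n) =
[x^(n-1)] G^n`.

It remains to show that the first quantity is at most `K / √n`, uniformly in `ℓ, m`, and that the
second is at least `c / √n` whenever it is nonzero; the quotient is then `O(n)`. The lower bound is
a local limit theorem (`exists_le_coeff_pow`). For the upper bound (`exists_coeff_numPairs_le`), if
`r ≤ n/2` then the coefficients of `G^(n-r)` are `O(n^(-1/2))` by Fourier inversion, while `G'(1) =
1` and `G''(1) < ∞` bound the total mass of the other factors. If `r > n/2`, the coefficient is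
estimated at a point `y < 1` where `G(y)/y` is so close to `1` that the factor `G'(y)^s` wins, which
gives exponential decay in `s`. -/

namespace GaltonWatson

open PowerSeries

/-! ### Words, prefixes and graph distance in the family tree -/

/-- The offspring numbers in the subtree of the descendants of the `i`-th child of the root. -/
def child (ξ : List ℕ → ℕ) (i : ℕ) : List ℕ → ℕ := fun u => ξ (i :: u)

lemma nil_mem_familyTree (ξ : List ℕ → ℕ) : [] ∈ familyTree ξ := by
  intro v i h
  simp at h

lemma cons_mem_familyTree {ξ : List ℕ → ℕ} {i : ℕ} {u : List ℕ} :
    i :: u ∈ familyTree ξ ↔ i < ξ [] ∧ u ∈ familyTree (child ξ i) := by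
  constructor
  · intro h
    refine ⟨h [] i (by simp), fun v j hv => ?_⟩
    exact h (i :: v) j (by simpa using hv)
  · rintro ⟨h1, h2⟩ v j hv
    cases v with
    | nil =>
      have : j = i := by simpa using hv
      exact this ▸ h1
    | cons a v =>
      rw [List.cons_append, List.cons_prefix_cons] at hv
      obtain ⟨rfl, hv⟩ := hv
      exact h2 v j hv

lemma mem_familyTree_of_prefix {ξ : List ℕ → ℕ} {u v : List ℕ} (hv : v ∈ familyTree ξ)
    (h : u <+: v) : u ∈ familyTree ξ :=
  fun w i hw => hv w i (hw.trans h)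

lemma lastCommonAncestor_prefix_left (v w : List ℕ) : lastCommonAncestor v w <+: v := by
  induction v generalizing w with
  | nil => cases w <;> simp [lastCommonAncestor]
  | cons a v ih =>
    cases w with
    | nil => simp [lastCommonAncestor]
    | cons b w =>
      by_cases h : a = b
      · simpa [lastCommonAncestor, h] using ih w
      · simp [lastCommonAncestor, h]

lemma lastCommonAncestor_comm (v w : List ℕ) :
    lastCommonAncestor v w = lastCommonAncestor w v := by
  induction v generalizing w with
  | nil => cases w <;> simp [lastCommonAncestor]
  | cons a v ih =>
    cases w with
    | nil => simp [lastCommonAncestor]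
    | cons b w =>
      by_cases h : a = b
      · simpa [lastCommonAncestor, h] using ih w
      · simp [lastCommonAncestor, h, Ne.symm h]

lemma lastCommonAncestor_prefix_right (v w : List ℕ) : lastCommonAncestor v w <+: w := by
  rw [lastCommonAncestor_comm]
  exact lastCommonAncestor_prefix_left w v

lemma length_le_of_walk {τ : Set (List ℕ)} {u v : List ℕ} (p : (treeGraph τ).Walk u v) :
    u.length ≤ v.length + p.length := by
  induction p with
  | nil => simp
  | cons h p ih =>
    rw [SimpleGraph.Walk.length_cons]
    obtain ⟨-, -, i, rfl | rfl⟩ := h <;>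
      simp only [List.length_append, List.length_singleton] at ih ⊢ <;> omega

lemma exists_walk_append {ξ : List ℕ → ℕ} (u w : List ℕ) (h : u ++ w ∈ familyTree ξ) :
    ∃ p : (treeGraph (familyTree ξ)).Walk (u ++ w) u, p.length = w.length := by
  induction w using List.reverseRecOn with
  | nil => exact ⟨SimpleGraph.Walk.nil.copy (by simp) rfl, by simp⟩
  | append_singleton w i ih =>
    have h' : u ++ w ∈ familyTree ξ := mem_familyTree_of_prefix h (by simp)
    obtain ⟨p, hp⟩ := ih h'
    have hadj : (treeGraph (familyTree ξ)).Adj (u ++ (w ++ [i])) (u ++ w) :=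
      ⟨h, h', i, Or.inr (by simp)⟩
    exact ⟨SimpleGraph.Walk.cons hadj p, by simp [hp]⟩

/-- An edge changes the length of a word by one, and deleting letters from the end gives a walk
attaining this bound. That walk also rules out the default distance `0` of unreachable vertices. -/
lemma dist_of_prefix {ξ : List ℕ → ℕ} {u v : List ℕ} (hv : v ∈ familyTree ξ) (h : u <+: v) (l : ℕ) :
    (treeGraph (familyTree ξ)).dist v u = l ↔ v.length = u.length + l := by
  obtain ⟨w, rfl⟩ := h
  obtain ⟨p, hp⟩ := exists_walk_append u w hv
  have h1 := SimpleGraph.dist_le p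
  obtain ⟨q, hq⟩ := p.reachable.exists_walk_length_eq_dist
  have h2 := length_le_of_walk q
  simp only [List.length_append] at h2 ⊢
  omega

/-! ### Generations and pairs, decomposed at the root -/

open Classical in
/-- The size of the `l`-th generation. -/
noncomputable def genSize (l : ℕ) (ξ : List ℕ → ℕ) : ℝ≥0∞ :=
  ∑' v : List ℕ, if v ∈ familyTree ξ ∧ v.length = l then 1 else 0

open Classical in
/-- The number of pairs of vertices at distances `l` and `m` from their last common ancestor. -/
noncomputable def numPairs (l m : ℕ) (ξ : List ℕ → ℕ) : ℝ≥0∞ :=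
  ∑' (v : List ℕ) (w : List ℕ), if v ∈ familyTree ξ ∧ w ∈ familyTree ξ ∧
    v.length = (lastCommonAncestor v w).length + l ∧
    w.length = (lastCommonAncestor v w).length + m then 1 else 0

/-- The number of pairs as above whose last common ancestor is the root. -/
noncomputable def numRootPairs : ℕ → ℕ → (List ℕ → ℕ) → ℝ≥0∞
  | 0, 0, _ => 1
  | l + 1, 0, ξ => genSize (l + 1) ξ
  | 0, m + 1, ξ => genSize (m + 1) ξ
  | l + 1, m + 1, ξ => ∑ i ∈ Finset.range (ξ []), ∑ j ∈ (Finset.range (ξ [])).erase i,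
      genSize l (child ξ i) * genSize m (child ξ j)

lemma toENNReal_encard {α : Type*} (s : Set α) [DecidablePred (· ∈ s)] :
    ((s.encard : ℕ∞) : ℝ≥0∞) = ∑' a, if a ∈ s then 1 else 0 := by
  rw [← ENNReal.tsum_set_one, tsum_subtype s (fun _ => (1 : ℝ≥0∞))]
  exact tsum_congr fun a => by simp [Set.indicator_apply]

lemma pairCount_eq_numPairs (l m : ℕ) (ξ : List ℕ → ℕ) :
    (pairCount l m (familyTree ξ) : ℝ≥0∞) = numPairs l m ξ := by
  classical
  rw [pairCount, toENNReal_encard, numPairs, ← ENNReal.tsum_prod]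
  refine tsum_congr fun p => if_congr ?_ rfl rfl
  simp only [Set.mem_ofPred_eq]
  refine and_congr_right fun hv => and_congr_right fun hw => ?_
  rw [dist_of_prefix hv (lastCommonAncestor_prefix_left _ _),
    dist_of_prefix hw (lastCommonAncestor_prefix_right _ _)]

lemma tsum_list (f : List ℕ → ℝ≥0∞) : ∑' v, f v = f [] + ∑' (i : ℕ) (u : List ℕ), f (i :: u) := by
  classical
  rw [ENNReal.tsum_eq_add_tsum_ite [], ← ENNReal.tsum_prod]
  congr 1
  have hinj : Function.Injective (fun p : ℕ × List ℕ => p.1 :: p.2) := by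
    rintro ⟨a, b⟩ ⟨c, d⟩ h
    simpa using h
  rw [← hinj.tsum_eq]
  · simp
  · intro v hv
    cases v with
    | nil => simp at hv
    | cons i u => exact ⟨(i, u), rfl⟩

lemma tsum_ite_lt (k : ℕ) (f : ℕ → ℝ≥0∞) :
    ∑' i, (if i < k then f i else 0) = ∑ i ∈ Finset.range k, f i := by
  rw [tsum_eq_sum (s := Finset.range k) (fun i hi => if_neg (by simpa using hi))]
  exact Finset.sum_congr rfl fun i hi => if_pos (by simpa using hi)

lemma genSize_zero (ξ : List ℕ → ℕ) : genSize 0 ξ = 1 := by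
  rw [genSize, tsum_list]
  simp [nil_mem_familyTree]

lemma genSize_succ (l : ℕ) (ξ : List ℕ → ℕ) :
    genSize (l + 1) ξ = ∑ i ∈ Finset.range (ξ []), genSize l (child ξ i) := by
  classical
  rw [genSize, tsum_list, ← tsum_ite_lt]
  simp only [List.length_nil, Nat.zero_ne_add_one, and_false, if_false, zero_add]
  refine tsum_congr fun i => ?_
  simp only [cons_mem_familyTree, List.length_cons, Nat.add_right_cancel_iff]
  by_cases h : i < ξ [] <;> simp [h, genSize]

-- If both words of a pair start with the same letter `i`, deleting it shortens both words and their
-- common prefix by one, so the pair is counted in the subtree of child `i`. All other pairs meet at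
-- the root.
open Classical in
lemma numPairs_eq_add (l m : ℕ) (ξ : List ℕ → ℕ) :
    numPairs l m ξ = numRootPairs l m ξ
      + ∑ i ∈ Finset.range (ξ []), numPairs l m (child ξ i) := by
  set F : List ℕ → List ℕ → ℝ≥0∞ := fun v w => if v ∈ familyTree ξ ∧ w ∈ familyTree ξ ∧
    v.length = (lastCommonAncestor v w).length + l ∧
    w.length = (lastCommonAncestor v w).length + m then 1 else 0 with hF
  set S : ℕ → ℕ → ℝ≥0∞ := fun i j => ∑' (u : List ℕ) (w : List ℕ), F (i :: u) (j :: w) with hS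
  have key : numPairs l m ξ = (F [] [] + ∑' (j : ℕ) (w : List ℕ), F [] (j :: w)
      + ∑' (i : ℕ) (u : List ℕ), F (i :: u) []) + ∑' (i : ℕ) (j : ℕ), S i j := by
    have h1 : numPairs l m ξ = ∑' (v : List ℕ) (w : List ℕ), F v w := rfl
    rw [h1, tsum_list, tsum_list, add_assoc (_ + _)]
    congr 1
    rw [← ENNReal.tsum_add]
    refine tsum_congr fun i => ?_
    rw [ENNReal.tsum_comm (f := fun j u => ∑' w, F (i :: u) (j :: w)), ← ENNReal.tsum_add]
    exact tsum_congr fun u => tsum_list _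
  have hgen : ∀ m : ℕ, genSize (m + 1) ξ =
      ∑' (i : ℕ) (u : List ℕ), if i :: u ∈ familyTree ξ ∧ u.length = m then 1 else 0 := by
    intro m
    rw [genSize, tsum_list]
    simp
  have hl : ∀ v, lastCommonAncestor v [] = [] := fun v => by cases v <;> rfl
  have hl' : ∀ v, lastCommonAncestor [] v = [] := fun v => by cases v <;> rfl
  have hSii : ∀ i, S i i = if i < ξ [] then numPairs l m (child ξ i) else 0 := by
    intro i
    by_cases h : i < ξ [] <;>
      simp [hS, hF, numPairs, lastCommonAncestor, cons_mem_familyTree, h, add_right_comm]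
  -- Different first letters put the last common ancestor at the root, so both distances are
  -- positive; the truncated `l - 1` and `m - 1` only matter in that case.
  have hSij : ∀ i j, i ≠ j → S i j = if l = 0 ∨ m = 0 then 0 else if i < ξ [] ∧ j < ξ [] then
      genSize (l - 1) (child ξ i) * genSize (m - 1) (child ξ j) else 0 := by
    intro i j hij
    rcases l with _ | l
    · simp [hS, hF, lastCommonAncestor, hij]
    rcases m with _ | m
    · simp [hS, hF, lastCommonAncestor, hij]
    by_cases hi : i < ξ []
    · by_cases hj : j < ξ []
      · simp only [genSize, Nat.add_sub_cancel, hS, hF, ← ENNReal.tsum_mul_right,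
          ← ENNReal.tsum_mul_left]
        simp [lastCommonAncestor, hij, hi, hj, cons_mem_familyTree]
        rw [ENNReal.tsum_comm]
        refine tsum_congr fun w => tsum_congr fun u => ?_
        rw [← ite_and]
        exact if_congr (by tauto) rfl rfl
      · simp [hS, hF, cons_mem_familyTree, hj]
    · simp [hS, hF, cons_mem_familyTree, hi]
  have hSsum : ∑' (i : ℕ) (j : ℕ), S i j = ∑ i ∈ Finset.range (ξ []),
      (S i i + ∑ j ∈ (Finset.range (ξ [])).erase i, S i j) := by
    have h0 : ∀ i j, ¬ (i < ξ [] ∧ j < ξ []) → S i j = 0 := by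
      intro i j h
      by_cases hij : i = j
      · subst hij
        rw [hSii, if_neg (by tauto)]
      · rw [hSij i j hij, if_neg h, ite_self]
    rw [tsum_eq_sum (s := Finset.range (ξ []))
      (fun i hi => by simp [fun j => h0 i j (fun h => hi (by simpa using h.1))])]
    refine Finset.sum_congr rfl fun i hi => ?_
    rw [tsum_eq_sum (s := Finset.range (ξ []))
      (fun j hj => h0 i j (fun h => hj (by simpa using h.2))), Finset.add_sum_erase _ _ hi]
  rw [key, hSsum, Finset.sum_add_distrib, ← add_assoc, add_right_comm]
  congr 1
  · rcases l with _ | l <;> rcases m with _ | m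
    · have : ∑ i ∈ Finset.range (ξ []), ∑ j ∈ (Finset.range (ξ [])).erase i, S i j = 0 :=
        Finset.sum_eq_zero fun i _ => Finset.sum_eq_zero fun j hj => by
          rw [hSij i j (Finset.ne_of_mem_erase hj).symm]; simp
      rw [this]
      simp [hF, hl, hl', nil_mem_familyTree, numRootPairs]
    · have : ∑ i ∈ Finset.range (ξ []), ∑ j ∈ (Finset.range (ξ [])).erase i, S i j = 0 :=
        Finset.sum_eq_zero fun i _ => Finset.sum_eq_zero fun j hj => by
          rw [hSij i j (Finset.ne_of_mem_erase hj).symm]; simp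
      rw [this, numRootPairs, hgen]
      simp [hF, hl, hl', nil_mem_familyTree]
    · have : ∑ i ∈ Finset.range (ξ []), ∑ j ∈ (Finset.range (ξ [])).erase i, S i j = 0 :=
        Finset.sum_eq_zero fun i _ => Finset.sum_eq_zero fun j hj => by
          rw [hSij i j (Finset.ne_of_mem_erase hj).symm]; simp
      rw [this, numRootPairs, hgen]
      simp [hF, hl, hl', nil_mem_familyTree]
    · rw [numRootPairs]
      simp only [hF, hl, hl', nil_mem_familyTree]
      simp
      refine Finset.sum_congr rfl fun i hi => Finset.sum_congr rfl fun j hj => ?_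
      rw [hSij i j (Finset.ne_of_mem_erase hj).symm]
      simp [Finset.mem_range.mp hi, Finset.mem_range.mp (Finset.mem_of_mem_erase hj)]
  · exact Finset.sum_congr rfl fun i hi => by rw [hSii, if_pos (by simpa using hi)]

/-! ### The size of the tree as a monomial -/

/-- `X ^ n` for `n : ℕ∞`, with `X ^ ⊤ = 0`. -/
noncomputable def enatMonomial (n : ℕ∞) : ℝ≥0∞⟦X⟧ := if n = ⊤ then 0 else X ^ n.toNat

/-- `⊤` absorbs under addition as `0` does under multiplication, so infinite trees need no separate
treatment. -/
lemma enatMonomial_add (a b : ℕ∞) : enatMonomial (a + b) = enatMonomial a * enatMonomial b := by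
  induction a <;> induction b <;> simp [enatMonomial]
  rw [← pow_add, ← Nat.cast_add, ENat.toNat_natCast]

lemma enatMonomial_sum {ι : Type*} (s : Finset ι) (a : ι → ℕ∞) :
    enatMonomial (∑ i ∈ s, a i) = ∏ i ∈ s, enatMonomial (a i) := by
  classical
  induction s using Finset.induction_on with
  | empty => simp [enatMonomial]
  | insert i s hi ih => rw [Finset.sum_insert hi, Finset.prod_insert hi, enatMonomial_add, ih]

lemma coeff_enatMonomial (a : ℕ∞) (n : ℕ) :
    coeff n (enatMonomial a) = if a = n then 1 else 0 := by
  cases a with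
  | top => simp [enatMonomial]
  | coe k => simp [enatMonomial, coeff_X_pow, eq_comm]

/-- The monomial `X ^ |T|`, read as `0` if the family tree is infinite. -/
noncomputable def sizeMonomial (ξ : List ℕ → ℕ) : ℝ≥0∞⟦X⟧ := enatMonomial (familyTree ξ).encard

lemma coeff_sizeMonomial (ξ : List ℕ → ℕ) (n : ℕ) :
    coeff n (sizeMonomial ξ) = (sizeEvent n).indicator 1 ξ := by
  classical
  rw [sizeMonomial, coeff_enatMonomial, Set.indicator_apply]
  simp only [sizeEvent, Set.mem_ofPred_eq, Pi.one_apply]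
  congr

lemma encard_familyTree (ξ : List ℕ → ℕ) : (familyTree ξ).encard =
    1 + ∑ i ∈ Finset.range (ξ []), (familyTree (child ξ i)).encard := by
  classical
  refine ENat.toENNReal_inj.mp ?_
  rw [ENat.toENNReal_add, toENNReal_encard, tsum_list]
  have : ((∑ i ∈ Finset.range (ξ []), (familyTree (child ξ i)).encard : ℕ∞) : ℝ≥0∞)
      = ∑ i ∈ Finset.range (ξ []), (((familyTree (child ξ i)).encard : ℕ∞) : ℝ≥0∞) :=
    map_sum ENat.toENNRealRingHom _ _
  rw [this, ← tsum_ite_lt]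
  simp only [nil_mem_familyTree, if_true, ENat.toENNReal_one]
  congr 1
  refine tsum_congr fun i => ?_
  simp only [cons_mem_familyTree, toENNReal_encard]
  by_cases h : i < ξ [] <;> simp [h]

lemma sizeMonomial_eq_mul (ξ : List ℕ → ℕ) :
    sizeMonomial ξ = X * ∏ i ∈ Finset.range (ξ []), sizeMonomial (child ξ i) := by
  simp_rw [sizeMonomial]
  rw [encard_familyTree, enatMonomial_add, enatMonomial_sum]
  congr 1
  simp [enatMonomial]

end GaltonWatson

/-! ### Composition of power series over `ℝ≥0∞` and Lagrange inversion -/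

namespace GaltonWatson

open PowerSeries

/-- The composition `A(B)` of power series, where `B` has no constant term. -/
noncomputable def comp (A B : ℝ≥0∞⟦X⟧) : ℝ≥0∞⟦X⟧ :=
  PowerSeries.mk fun n => ∑' j, coeff j A * coeff n (B ^ j)

lemma coeff_comp_mul (A B F : ℝ≥0∞⟦X⟧) (n : ℕ) :
    coeff n (comp A B * F) = ∑' j, coeff j A * coeff n (B ^ j * F) := by
  simp only [coeff_mul, comp, coeff_mk, Finset.mul_sum, ← ENNReal.tsum_mul_right]
  rw [Summable.tsum_finsetSum fun _ _ => ENNReal.summable]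
  exact Finset.sum_congr rfl fun p _ => tsum_congr fun j => by ring

/-- Sums in `ℝ≥0∞` rearrange freely, so `B` may have a constant term; evaluation at a point later
uses this with `B` constant. -/
lemma comp_mul (A A' B : ℝ≥0∞⟦X⟧) : comp (A * A') B = comp A B * comp A' B := by
  ext n
  rw [coeff_comp_mul]
  have h : ∀ j, coeff n (B ^ j * comp A' B) = ∑' i, coeff i A' * coeff n (B ^ (j + i)) := by
    intro j
    rw [mul_comm, coeff_comp_mul]
    exact tsum_congr fun i => by rw [pow_add, mul_comm (B ^ j)]
  simp_rw [h, ← ENNReal.tsum_mul_left]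
  rw [← ENNReal.tsum_prod (f := fun j i => coeff j A * (coeff i A' * coeff n (B ^ (j + i)))),
    ← Equiv.tsum_eq Finset.HasAntidiagonal.sigmaAntidiagonalEquivProd, ENNReal.tsum_sigma']
  simp only [comp, coeff_mk, coeff_mul]
  refine tsum_congr fun k => ?_
  rw [tsum_fintype, Finset.sum_mul, ← Finset.sum_coe_sort]
  refine Finset.sum_congr rfl fun p _ => ?_
  have := Finset.HasAntidiagonal.mem_antidiagonal.mp p.2
  simp [Finset.HasAntidiagonal.sigmaAntidiagonalEquivProd, this, mul_assoc]

lemma comp_one (B : ℝ≥0∞⟦X⟧) : comp 1 B = 1 := by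
  ext n
  rw [comp, coeff_mk, tsum_eq_single 0 (fun j hj => by simp [coeff_one, hj])]
  simp

lemma comp_X (B : ℝ≥0∞⟦X⟧) : comp X B = B := by
  ext n
  rw [comp, coeff_mk, tsum_eq_single 1 (fun j hj => by simp [coeff_X, hj])]
  simp

lemma comp_pow (A B : ℝ≥0∞⟦X⟧) (k : ℕ) : comp (A ^ k) B = comp A B ^ k := by
  induction k with
  | zero => simp [comp_one]
  | succ k ih => rw [pow_succ, pow_succ, comp_mul, ih]

/-- Uniqueness of the solution of the linear equation `Y = F + X * D * Y`. -/
lemma eq_of_eq_add_X_mul {F D Y Y' : ℝ≥0∞⟦X⟧} (h : Y = F + X * (D * Y))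
    (h' : Y' = F + X * (D * Y')) : Y = Y' := by
  ext n
  induction n using Nat.strong_induction_on with
  | _ n ih =>
    rw [h, h', map_add, map_add]
    congr 1
    cases n with
    | zero => simp
    | succ n =>
      rw [coeff_succ_X_mul, coeff_succ_X_mul, coeff_mul, coeff_mul]
      refine Finset.sum_congr rfl fun p hp => ?_
      rw [ih p.2 (by have := Finset.HasAntidiagonal.mem_antidiagonal.mp hp; omega)]

/-- The geometric series in `X * D`. -/
noncomputable def geom (D : ℝ≥0∞⟦X⟧) : ℝ≥0∞⟦X⟧ :=
  PowerSeries.mk fun n => ∑' i, coeff n ((X * D) ^ i)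

lemma geom_eq (D : ℝ≥0∞⟦X⟧) : geom D = 1 + X * (D * geom D) := by
  ext n
  rw [← mul_assoc, map_add, geom, coeff_mk, tsum_eq_zero_add' ENNReal.summable, pow_zero]
  congr 1
  simp only [coeff_mul n (X * D), coeff_mk, ← ENNReal.tsum_mul_left]
  rw [← Summable.tsum_finsetSum fun _ _ => ENNReal.summable]
  exact tsum_congr fun i => by rw [pow_succ', coeff_mul]

/-- This is `Y = F / (1 - X D)`; as `ℝ≥0∞` has no additive inverses, uniqueness of the solution
replaces the division. -/
lemma eq_mul_geom {F D Y : ℝ≥0∞⟦X⟧} (h : Y = F + X * (D * Y)) : Y = F * geom D := by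
  refine eq_of_eq_add_X_mul h ?_
  conv_lhs => rw [geom_eq]
  ring

/-- **Lagrange inversion** for monomials. -/
lemma coeff_pow_mul_geom {G T : ℝ≥0∞⟦X⟧} (hT : T = X * comp G T) (n j : ℕ) :
    coeff n (T ^ j * geom (comp (d⁄dX ℝ≥0∞ G) T)) = coeff n (X ^ j * G ^ n) := by
  induction n generalizing j with
  | zero =>
    cases j with
    | zero => rw [geom_eq]; simp
    | succ j => rw [pow_succ, hT]; simp
  | succ n ih =>
    cases j with
    | zero =>
      -- For `j = 0`, one step of the geometric recursion lowers the degree, and the induction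
      -- hypothesis for all exponents evaluates `G'(T)` times the geometric series.
      have h1 : coeff (n + 1) (T ^ 0 * geom (comp (d⁄dX ℝ≥0∞ G) T))
          = coeff n (d⁄dX ℝ≥0∞ G * G ^ n) := by
        rw [pow_zero, one_mul, geom_eq, map_add, coeff_succ_X_mul, coeff_comp_mul]
        simp only [ih]
        rw [tsum_eq_sum (s := Finset.range (n + 1))]
        · rw [coeff_mul, Finset.Nat.sum_antidiagonal_eq_sum_range_succ
            (fun a b => coeff a (d⁄dX ℝ≥0∞ G) * coeff b (G ^ n)), coeff_one]
          simp only [Nat.add_eq_zero_iff, one_ne_zero, and_false, if_false, zero_add]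
          refine Finset.sum_congr rfl fun i hi => ?_
          rw [coeff_X_pow_mul', if_pos (by simpa [Nat.lt_succ_iff] using hi)]
        · intro i hi
          rw [coeff_X_pow_mul', if_neg (by simpa [Nat.lt_succ_iff] using hi), mul_zero]
      -- Read off from `(G^(n+1))' = (n+1) G' G^n`; the factor `n + 1` is then cancelled.
      have h2 : coeff (n + 1) (G ^ (n + 1)) * ((n : ℝ≥0∞) + 1)
          = coeff n (d⁄dX ℝ≥0∞ G * G ^ n) * ((n : ℝ≥0∞) + 1) := by
        rw [← coeff_derivative, derivative_pow, Nat.add_sub_cancel, mul_assoc,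
          ← map_natCast (C (R := ℝ≥0∞)), coeff_C_mul, mul_comm (G ^ n)]
        push_cast
        ring
      rw [h1, pow_zero, one_mul]
      refine ((ENNReal.mul_left_inj ?_ ?_).mp h2).symm
      · positivity
      · exact ENNReal.add_ne_top.mpr ⟨ENNReal.natCast_ne_top n, ENNReal.one_ne_top⟩
    | succ j =>
      -- For a positive exponent, one factor `T` is replaced by `X G(T)`, which lowers the degree.
      rw [pow_succ', mul_assoc]
      nth_rw 1 [hT]
      rw [mul_assoc, coeff_succ_X_mul, coeff_comp_mul]
      simp only [← mul_assoc, ← pow_add, ih]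
      rw [pow_succ', mul_assoc, coeff_succ_X_mul, pow_succ', ← mul_assoc, ← mul_comm G, mul_assoc,
        coeff_mul, tsum_eq_sum (s := Finset.range (n + 1))]
      · rw [Finset.Nat.sum_antidiagonal_eq_sum_range_succ
            (fun a b => coeff a G * coeff b (X ^ j * G ^ n))]
        refine Finset.sum_congr rfl fun i hi => ?_
        rw [pow_add, mul_assoc, coeff_X_pow_mul', if_pos (by simpa [Nat.lt_succ_iff] using hi)]
      · intro i hi
        rw [pow_add, mul_assoc, coeff_X_pow_mul', if_neg (by simpa [Nat.lt_succ_iff] using hi),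
          mul_zero]

/-- **Lagrange inversion**. -/
lemma coeff_comp_mul_geom {G T : ℝ≥0∞⟦X⟧} (hT : T = X * comp G T) (A : ℝ≥0∞⟦X⟧) (n : ℕ) :
    coeff n (comp A T * geom (comp (d⁄dX ℝ≥0∞ G) T)) = coeff n (A * G ^ n) := by
  rw [coeff_comp_mul]
  simp only [coeff_pow_mul_geom hT]
  rw [tsum_eq_sum (s := Finset.range (n + 1)), coeff_mul,
    Finset.Nat.sum_antidiagonal_eq_sum_range_succ (fun a b => coeff a A * coeff b (G ^ n))]
  · refine Finset.sum_congr rfl fun i hi => ?_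
    rw [coeff_X_pow_mul', if_pos (by simpa [Nat.lt_succ_iff] using hi)]
  · intro i hi
    rw [coeff_X_pow_mul', if_neg (by simpa [Nat.lt_succ_iff] using hi), mul_zero]

end GaltonWatson

/-! ### Random power series and the law of the tree at the root -/

namespace GaltonWatson

open PowerSeries

section Product

variable {Ω : Type*} [MeasurableSpace Ω]

/-- The coefficientwise expectation of a random power series. -/
noncomputable def expSeries (μ : Measure Ω) (P : Ω → ℝ≥0∞⟦X⟧) : ℝ≥0∞⟦X⟧ :=
  PowerSeries.mk fun n => ∫⁻ ω, coeff n (P ω) ∂μ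

/-- Coefficientwise measurability of a random power series. -/
def MeasurableCoeff (P : Ω → ℝ≥0∞⟦X⟧) : Prop := ∀ n, Measurable fun ω => coeff n (P ω)

lemma MeasurableCoeff.mul {P Q : Ω → ℝ≥0∞⟦X⟧} (hP : MeasurableCoeff P) (hQ : MeasurableCoeff Q) :
    MeasurableCoeff fun ω => P ω * Q ω := by
  intro n
  simp only [coeff_mul]
  exact Finset.measurable_fun_sum _ fun p _ => (hP p.1).mul (hQ p.2)

lemma MeasurableCoeff.prod {ι : Type*} {s : Finset ι} {P : ι → Ω → ℝ≥0∞⟦X⟧}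
    (hP : ∀ i, MeasurableCoeff (P i)) : MeasurableCoeff fun ω => ∏ i ∈ s, P i ω := by
  classical
  intro n
  simp only [coeff_prod]
  exact Finset.measurable_fun_sum _ fun l _ => Finset.measurable_fun_prod _ fun i _ => hP i (l i)

lemma MeasurableCoeff.C_mul {Z : Ω → ℝ≥0∞} {P : Ω → ℝ≥0∞⟦X⟧} (hZ : Measurable Z)
    (hP : MeasurableCoeff P) : MeasurableCoeff fun ω => C (Z ω) * P ω := by
  intro n
  simp only [coeff_C_mul]
  exact hZ.mul (hP n)

lemma MeasurableCoeff.comp {Ω' : Type*} [MeasurableSpace Ω'] {P : Ω → ℝ≥0∞⟦X⟧} {f : Ω' → Ω}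
    (hP : MeasurableCoeff P) (hf : Measurable f) : MeasurableCoeff fun ω => P (f ω) :=
  fun n => (hP n).comp hf

lemma expSeries_add (μ : Measure Ω) {P Q : Ω → ℝ≥0∞⟦X⟧} (hP : MeasurableCoeff P) :
    expSeries μ (fun ω => P ω + Q ω) = expSeries μ P + expSeries μ Q := by
  ext n
  simp only [expSeries, coeff_mk, map_add]
  exact lintegral_add_left (hP n) _

lemma expSeries_sum (μ : Measure Ω) {ι : Type*} (s : Finset ι) {P : ι → Ω → ℝ≥0∞⟦X⟧}
    (hP : ∀ i, MeasurableCoeff (P i)) :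
    expSeries μ (fun ω => ∑ i ∈ s, P i ω) = ∑ i ∈ s, expSeries μ (P i) := by
  ext n
  simp only [expSeries, coeff_mk, map_sum]
  exact lintegral_finsetSum _ fun i _ => hP i n

/-- A coefficient of the product is a finite sum of products of functions of distinct, hence
independent, coordinates. -/
lemma expSeries_prod_infinitePi (μ : Measure Ω) [IsProbabilityMeasure μ] (s : Finset ℕ)
    {P : ℕ → Ω → ℝ≥0∞⟦X⟧} (hP : ∀ i, MeasurableCoeff (P i)) :
    expSeries (Measure.infinitePi fun _ : ℕ => μ) (fun w => ∏ i ∈ s, P i (w i))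
      = ∏ i ∈ s, expSeries μ (P i) := by
  classical
  ext n
  simp only [expSeries, coeff_mk, coeff_prod]
  rw [lintegral_finsetSum _ fun l _ => Finset.measurable_fun_prod _ fun i _ =>
    (hP i (l i)).comp (measurable_pi_apply i)]
  refine Finset.sum_congr rfl fun l _ => ?_
  refine (lintegral_prod_eq_prod_lintegral_of_indepFun s
    (fun i (w : ℕ → Ω) => coeff (l i) (P i (w i)))
    (iIndepFun_infinitePi (X := fun i (ω : Ω) => coeff (l i) (P i ω)) fun i => hP i (l i))
    fun i => (hP i (l i)).comp (measurable_pi_apply i)).trans ?_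
  refine Finset.prod_congr rfl fun i _ => ?_
  exact (measurePreserving_eval_infinitePi (fun _ : ℕ => μ) i).lintegral_comp (hP i (l i))

end Product

lemma measurable_child (i : ℕ) : Measurable fun ξ : List ℕ → ℕ => child ξ i :=
  measurable_pi_lambda _ fun u => measurable_pi_apply (i :: u)

lemma measurableSet_mem_familyTree (v : List ℕ) :
    MeasurableSet {ξ : List ℕ → ℕ | v ∈ familyTree ξ} := by
  have : {ξ : List ℕ → ℕ | v ∈ familyTree ξ}
      = ⋂ (w : List ℕ), ⋂ (i : ℕ), ⋂ (_ : w ++ [i] <+: v), {ξ | i < ξ w} := by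
    ext ξ
    simp [familyTree]
  rw [this]
  exact MeasurableSet.iInter fun w => MeasurableSet.iInter fun i => MeasurableSet.iInter fun _ =>
    measurableSet_lt measurable_const (measurable_pi_apply w)

lemma measurable_genSize (l : ℕ) : Measurable (genSize l) := by
  classical
  unfold genSize
  refine Measurable.tsum fun v => Measurable.ite ?_ measurable_const measurable_const
  exact (measurableSet_mem_familyTree v).inter (MeasurableSet.const _)

lemma measurable_numPairs (l m : ℕ) : Measurable (numPairs l m) := by
  classical
  unfold numPairs
  refine Measurable.tsum fun v => Measurable.tsum fun w =>
    Measurable.ite ?_ measurable_const measurable_const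
  exact (measurableSet_mem_familyTree v).inter
    ((measurableSet_mem_familyTree w).inter (MeasurableSet.const _))

lemma measurableSet_sizeEvent (n : ℕ) : MeasurableSet (sizeEvent n) := by
  classical
  have : sizeEvent n = {ξ | ∑' v : List ℕ, (if v ∈ familyTree ξ then 1 else 0 : ℝ≥0∞) = n} := by
    ext ξ
    simp only [sizeEvent, Set.mem_ofPred_eq]
    rw [← toENNReal_encard, ← ENat.toENNReal_inj, ENat.toENNReal_coe]
  rw [this]
  refine measurableSet_eq_fun (Measurable.tsum fun v => ?_) measurable_const
  exact Measurable.ite (measurableSet_mem_familyTree v) measurable_const measurable_const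

lemma measurableCoeff_sizeMonomial : MeasurableCoeff sizeMonomial := by
  intro n
  simp only [coeff_sizeMonomial]
  exact measurable_one.indicator (measurableSet_sizeEvent n)

variable (ν : Measure ℕ) [IsProbabilityMeasure ν]

instance : IsProbabilityMeasure (gwMeasure ν) := by
  unfold gwMeasure; infer_instance

/-- The law of the offspring number of the root and of the subtrees of its children. -/
lemma map_gwMeasure : (gwMeasure ν).map (fun ξ => (ξ [], child ξ)) =
    ν.prod (Measure.infinitePi fun _ : ℕ => gwMeasure ν) := by
  have hchild : Measurable (child : (List ℕ → ℕ) → ℕ → List ℕ → ℕ) :=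
    measurable_pi_lambda _ measurable_child
  have hind : iIndepFun (fun (u : List ℕ) (ξ : List ℕ → ℕ) => ξ u) (gwMeasure ν) :=
    iIndepFun_infinitePi (X := fun _ k => k) fun _ => measurable_id
  have hindep : IndepFun (fun ξ : List ℕ → ℕ => ξ []) (child : (List ℕ → ℕ) → _)
      (gwMeasure ν) := by
    -- The root and the nonempty words index disjoint families of independent variables.
    have h := indep_iSup_of_disjoint (fun u => (measurable_pi_apply u).comap_le) hind
      (S := {[]}) (T := {[]}ᶜ) (by simp)
    refine indep_of_indep_of_le_left (indep_of_indep_of_le_right h ?_) ?_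
    · rw [← measurable_iff_comap_le]
      refine @measurable_pi_lambda _ _ _ (_) _ _ fun i =>
        @measurable_pi_lambda _ _ _ (_) _ _ fun u => ?_
      have hle : MeasurableSpace.comap (fun ξ : List ℕ → ℕ => ξ (i :: u)) inferInstance
          ≤ ⨆ v ∈ ({[]}ᶜ : Set (List ℕ)), MeasurableSpace.comap (fun ξ => ξ v) inferInstance :=
        le_iSup₂_of_le (i :: u) (by simp) le_rfl
      exact measurable_iff_comap_le.mpr hle
    · exact le_iSup₂_of_le [] (by simp) le_rfl
  rw [IndepFun.map_prod_eq_prod_map_map (measurable_pi_apply _).aemeasurable hchild.aemeasurable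
    hindep]
  congr 1
  · exact Measure.infinitePi_map_eval _ _
  -- Nonempty words correspond to pairs (first letter, rest); reindexing and currying turn the
  -- remaining product law into a sequence of independent copies of the tree.
  · have hinj : Function.Injective (fun p : ℕ × List ℕ => p.1 :: p.2) := by
      rintro ⟨a, b⟩ ⟨c, d⟩ h
      simpa using h
    have h1 := Measure.map_infinitePi_infinitePi_of_inj (P := fun _ : List ℕ => ν) hinj
    have h2 := Measure.infinitePi_map_curry (ι := ℕ) (κ := List ℕ) (fun _ _ => ν)
    rw [← h1, Measure.map_map (by fun_prop) (by fun_prop)] at h2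
    exact h2

/-- The coefficientwise form of the decomposition of the tree at the root. -/
lemma coeff_expSeries_gwMeasure {Q : ℕ → (ℕ → List ℕ → ℕ) → ℝ≥0∞⟦X⟧}
    (hQ : ∀ k, MeasurableCoeff (Q k)) (n : ℕ) :
    coeff n (expSeries (gwMeasure ν) fun ξ => Q (ξ []) (child ξ)) =
      ∑' k, ν {k} * coeff n (expSeries (Measure.infinitePi fun _ : ℕ => gwMeasure ν) (Q k)) := by
  have hm : Measurable fun p : ℕ × (ℕ → List ℕ → ℕ) => coeff n (Q p.1 p.2) :=
    measurable_from_prod_countable_right fun k => hQ k n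
  have hf : Measurable fun ξ : List ℕ → ℕ => (ξ [], child ξ) :=
    (measurable_pi_apply _).prodMk (measurable_pi_lambda _ measurable_child)
  simp only [expSeries, coeff_mk]
  rw [← lintegral_map hm hf, map_gwMeasure, lintegral_prod _ hm.aemeasurable, lintegral_countable']
  simp only [mul_comm]

/-- The generating function `n ↦ E[Z; |T| = n]`. -/
noncomputable def sizeSeries (Z : (List ℕ → ℕ) → ℝ≥0∞) : ℝ≥0∞⟦X⟧ :=
  expSeries (gwMeasure ν) fun ξ => C (Z ξ) * sizeMonomial ξ

/-- The generating function of the total size. -/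
noncomputable def treeSeries : ℝ≥0∞⟦X⟧ := expSeries (gwMeasure ν) sizeMonomial

/-- The generating function of the offspring law. -/
noncomputable def offspringSeries : ℝ≥0∞⟦X⟧ := PowerSeries.mk fun k => ν {k}

lemma sizeSeries_one : sizeSeries ν (fun _ => 1) = treeSeries ν := by
  simp [sizeSeries, treeSeries]

lemma coeff_sizeSeries (Z : (List ℕ → ℕ) → ℝ≥0∞) (n : ℕ) :
    coeff n (sizeSeries ν Z) = ∫⁻ ξ in sizeEvent n, Z ξ ∂gwMeasure ν := by
  rw [sizeSeries, expSeries, coeff_mk, ← lintegral_indicator (measurableSet_sizeEvent n)]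
  refine lintegral_congr fun ξ => ?_
  rw [coeff_C_mul, coeff_sizeMonomial]
  by_cases h : ξ ∈ sizeEvent n <;> simp [h]

/-- The weight is moved into the `i`-th factor, so that independence applies to a plain product over
the trees of the forest. -/
lemma expSeries_forest_one {Z : (List ℕ → ℕ) → ℝ≥0∞} (hZ : Measurable Z) {s : Finset ℕ} {i : ℕ}
    (hi : i ∈ s) :
    expSeries (Measure.infinitePi fun _ : ℕ => gwMeasure ν)
      (fun w => C (Z (w i)) * ∏ a ∈ s, sizeMonomial (w a))
      = sizeSeries ν Z * treeSeries ν ^ (s.card - 1) := by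
  set P : ℕ → (List ℕ → ℕ) → ℝ≥0∞⟦X⟧ := fun a ξ =>
    if a = i then C (Z ξ) * sizeMonomial ξ else sizeMonomial ξ with hP
  have hPm : ∀ a, MeasurableCoeff (P a) := by
    intro a
    by_cases h : a = i
    · simpa [hP, h] using measurableCoeff_sizeMonomial.C_mul hZ
    · simpa [hP, h] using measurableCoeff_sizeMonomial
  have h1 : ∀ w : ℕ → List ℕ → ℕ,
      C (Z (w i)) * ∏ a ∈ s, sizeMonomial (w a) = ∏ a ∈ s, P a (w a) := by
    intro w
    rw [← Finset.mul_prod_erase _ _ hi, ← Finset.mul_prod_erase s _ hi, ← mul_assoc]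
    congr 1
    · simp [hP]
    · exact Finset.prod_congr rfl fun a ha => by simp [hP, Finset.ne_of_mem_erase ha]
  simp only [h1]
  rw [expSeries_prod_infinitePi _ _ hPm, ← Finset.mul_prod_erase _ _ hi,
    ← Finset.card_erase_of_mem hi, ← Finset.prod_const]
  congr 1
  · simp [hP, sizeSeries]
  · exact Finset.prod_congr rfl fun a ha => by
      simp only [hP, Finset.ne_of_mem_erase ha, if_false]; rfl

lemma expSeries_forest_two {Z Z' : (List ℕ → ℕ) → ℝ≥0∞} (hZ : Measurable Z) (hZ' : Measurable Z')
    {s : Finset ℕ} {i j : ℕ} (hi : i ∈ s) (hj : j ∈ s.erase i) :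
    expSeries (Measure.infinitePi fun _ : ℕ => gwMeasure ν)
      (fun w => C (Z (w i) * Z' (w j)) * ∏ a ∈ s, sizeMonomial (w a))
      = sizeSeries ν Z * sizeSeries ν Z' * treeSeries ν ^ (s.card - 2) := by
  have hji : j ≠ i := Finset.ne_of_mem_erase hj
  set P : ℕ → (List ℕ → ℕ) → ℝ≥0∞⟦X⟧ := fun a ξ =>
    if a = i then C (Z ξ) * sizeMonomial ξ else
      if a = j then C (Z' ξ) * sizeMonomial ξ else sizeMonomial ξ with hP
  have hPm : ∀ a, MeasurableCoeff (P a) := by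
    intro a
    by_cases h : a = i
    · simpa [hP, h] using measurableCoeff_sizeMonomial.C_mul hZ
    · by_cases h' : a = j
      · simpa [hP, h', hji] using measurableCoeff_sizeMonomial.C_mul hZ'
      · simpa [hP, h, h'] using measurableCoeff_sizeMonomial
  have hne : ∀ a ∈ (s.erase i).erase j, a ≠ i ∧ a ≠ j := fun a ha =>
    ⟨Finset.ne_of_mem_erase (Finset.mem_of_mem_erase ha), Finset.ne_of_mem_erase ha⟩
  have h1 : ∀ w : ℕ → List ℕ → ℕ,
      C (Z (w i) * Z' (w j)) * ∏ a ∈ s, sizeMonomial (w a) = ∏ a ∈ s, P a (w a) := by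
    intro w
    have h2 : ∏ a ∈ (s.erase i).erase j, sizeMonomial (w a)
        = ∏ a ∈ (s.erase i).erase j, P a (w a) :=
      Finset.prod_congr rfl fun a ha => by simp [hP, hne a ha]
    rw [← Finset.mul_prod_erase _ _ hi, ← Finset.mul_prod_erase s _ hi,
      ← Finset.mul_prod_erase _ _ hj, ← Finset.mul_prod_erase (s.erase i) _ hj, h2]
    simp only [hP, if_true, hji, if_false, map_mul]
    ring
  simp only [h1]
  have hcard : ((s.erase i).erase j).card = s.card - 2 := by
    rw [Finset.card_erase_of_mem hj, Finset.card_erase_of_mem hi, Nat.sub_sub]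
  rw [expSeries_prod_infinitePi _ _ hPm, ← Finset.mul_prod_erase _ _ hi,
    ← Finset.mul_prod_erase _ _ hj, ← hcard, ← Finset.prod_const, mul_assoc]
  congr 1
  · simp [hP, sizeSeries]
  congr 1
  · simp [hP, sizeSeries, hji]
  · exact Finset.prod_congr rfl fun a ha => by simp only [hP, hne a ha, if_false]; rfl

end GaltonWatson

/-! ### Generating functions of sizes, generations and pairs -/

namespace GaltonWatson

open PowerSeries

lemma expSeries_X_mul {Ω : Type*} [MeasurableSpace Ω] (μ : Measure Ω) (P : Ω → ℝ≥0∞⟦X⟧) :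
    expSeries μ (fun ω => X * P ω) = X * expSeries μ P := by
  ext n
  cases n <;> simp [expSeries, coeff_succ_X_mul]

variable (ν : Measure ℕ) [IsProbabilityMeasure ν]

lemma measurableCoeff_forest (s : Finset ℕ) :
    MeasurableCoeff fun w : ℕ → List ℕ → ℕ => ∏ a ∈ s, sizeMonomial (w a) :=
  MeasurableCoeff.prod fun i => measurableCoeff_sizeMonomial.comp (measurable_pi_apply i)

lemma treeSeries_eq : treeSeries ν = X * comp (offspringSeries ν) (treeSeries ν) := by
  have h1 : treeSeries ν = X * expSeries (gwMeasure ν)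
      fun ξ => (fun k (w : ℕ → List ℕ → ℕ) => ∏ a ∈ Finset.range k, sizeMonomial (w a))
        (ξ []) (child ξ) := by
    rw [← expSeries_X_mul, treeSeries]
    congr 1
    funext ξ
    exact sizeMonomial_eq_mul ξ
  have h2 : ∀ k, expSeries (Measure.infinitePi fun _ : ℕ => gwMeasure ν)
      (fun w => ∏ a ∈ Finset.range k, sizeMonomial (w a)) = treeSeries ν ^ k := by
    intro k
    rw [expSeries_prod_infinitePi _ _ fun _ => measurableCoeff_sizeMonomial]
    simp [treeSeries]
  refine h1.trans ?_
  congr 1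
  ext n
  rw [coeff_expSeries_gwMeasure ν (fun k => measurableCoeff_forest (Finset.range k))]
  simp only [h2, comp, coeff_mk, offspringSeries]

/-- Decomposition at the root of a sum over the subtrees of the children of the root. -/
lemma sizeSeries_sum {Z : (List ℕ → ℕ) → ℝ≥0∞} (hZ : Measurable Z) :
    sizeSeries ν (fun ξ => ∑ i ∈ Finset.range (ξ []), Z (child ξ i)) =
      X * (comp (d⁄dX ℝ≥0∞ (offspringSeries ν)) (treeSeries ν) * sizeSeries ν Z) := by
  set Q : ℕ → (ℕ → List ℕ → ℕ) → ℝ≥0∞⟦X⟧ := fun k w => ∑ i ∈ Finset.range k,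
    C (Z (w i)) * ∏ a ∈ Finset.range k, sizeMonomial (w a) with hQ
  have hQi : ∀ k i, MeasurableCoeff fun w : ℕ → List ℕ → ℕ =>
      C (Z (w i)) * ∏ a ∈ Finset.range k, sizeMonomial (w a) := fun k i =>
    (measurableCoeff_forest (Finset.range k)).C_mul (hZ.comp (measurable_pi_apply i))
  have hQm : ∀ k, MeasurableCoeff (Q k) := by
    intro k n
    simp only [hQ, map_sum]
    exact Finset.measurable_fun_sum _ fun i _ => hQi k i n
  have h1 : sizeSeries ν (fun ξ => ∑ i ∈ Finset.range (ξ []), Z (child ξ i)) =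
      X * expSeries (gwMeasure ν) fun ξ => Q (ξ []) (child ξ) := by
    rw [← expSeries_X_mul, sizeSeries]
    congr 1
    funext ξ
    rw [sizeMonomial_eq_mul, map_sum, Finset.sum_mul, hQ, Finset.mul_sum]
    exact Finset.sum_congr rfl fun i _ => by ring
  -- The `k` choices of a child each contribute `T^(k-1)`; averaging `k T^(k-1)` over the offspring
  -- law produces `G'(T)`.
  have h2 : ∀ k, expSeries (Measure.infinitePi fun _ : ℕ => gwMeasure ν) (Q k) =
      C (k : ℝ≥0∞) * (treeSeries ν ^ (k - 1) * sizeSeries ν Z) := by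
    intro k
    rw [hQ, expSeries_sum _ _ (hQi k), Finset.sum_congr rfl fun i hi =>
      expSeries_forest_one ν hZ hi]
    simp [mul_comm]
  rw [h1]
  congr 1
  ext n
  rw [coeff_expSeries_gwMeasure ν hQm, coeff_comp_mul, tsum_eq_zero_add' ENNReal.summable]
  simp only [h2, coeff_C_mul, coeff_derivative, offspringSeries, coeff_mk]
  simp [mul_assoc]

/-- Decomposition at the root of a sum over pairs of distinct children of the root. -/
lemma sizeSeries_sum_sum {Z Z' : (List ℕ → ℕ) → ℝ≥0∞} (hZ : Measurable Z) (hZ' : Measurable Z') :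
    sizeSeries ν (fun ξ => ∑ i ∈ Finset.range (ξ []), ∑ j ∈ (Finset.range (ξ [])).erase i,
      Z (child ξ i) * Z' (child ξ j)) =
      X * (comp (d⁄dX ℝ≥0∞ (d⁄dX ℝ≥0∞ (offspringSeries ν))) (treeSeries ν) *
        (sizeSeries ν Z * sizeSeries ν Z')) := by
  set Q : ℕ → (ℕ → List ℕ → ℕ) → ℝ≥0∞⟦X⟧ := fun k w => ∑ i ∈ Finset.range k,
    ∑ j ∈ (Finset.range k).erase i,
      C (Z (w i) * Z' (w j)) * ∏ a ∈ Finset.range k, sizeMonomial (w a) with hQ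
  have hQij : ∀ k i j, MeasurableCoeff fun w : ℕ → List ℕ → ℕ =>
      C (Z (w i) * Z' (w j)) * ∏ a ∈ Finset.range k, sizeMonomial (w a) := fun k i j =>
    (measurableCoeff_forest (Finset.range k)).C_mul
      ((hZ.comp (measurable_pi_apply i)).mul (hZ'.comp (measurable_pi_apply j)))
  have hQi : ∀ k i, MeasurableCoeff fun w : ℕ → List ℕ → ℕ => ∑ j ∈ (Finset.range k).erase i,
      C (Z (w i) * Z' (w j)) * ∏ a ∈ Finset.range k, sizeMonomial (w a) := by
    intro k i n
    simp only [map_sum]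
    exact Finset.measurable_fun_sum _ fun j _ => hQij k i j n
  have hQm : ∀ k, MeasurableCoeff (Q k) := by
    intro k n
    simp only [hQ, map_sum _ _ (Finset.range k)]
    exact Finset.measurable_fun_sum _ fun i _ => hQi k i n
  have h1 : sizeSeries ν (fun ξ => ∑ i ∈ Finset.range (ξ []),
      ∑ j ∈ (Finset.range (ξ [])).erase i, Z (child ξ i) * Z' (child ξ j)) =
      X * expSeries (gwMeasure ν) fun ξ => Q (ξ []) (child ξ) := by
    rw [← expSeries_X_mul, sizeSeries]
    congr 1
    funext ξ
    rw [sizeMonomial_eq_mul, map_sum, Finset.sum_mul, hQ, Finset.mul_sum]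
    refine Finset.sum_congr rfl fun i _ => ?_
    rw [map_sum, Finset.sum_mul, Finset.mul_sum]
    exact Finset.sum_congr rfl fun j _ => by ring
  -- There are `k (k-1)` ordered pairs of distinct children, hence `G''(T)`.
  have h2 : ∀ k, expSeries (Measure.infinitePi fun _ : ℕ => gwMeasure ν) (Q k) =
      C ((k : ℝ≥0∞) * ((k - 1 : ℕ) : ℝ≥0∞)) *
        (treeSeries ν ^ (k - 2) * (sizeSeries ν Z * sizeSeries ν Z')) := by
    intro k
    rw [hQ, expSeries_sum _ _ (hQi k)]
    have h3 : ∀ i ∈ Finset.range k, expSeries (Measure.infinitePi fun _ : ℕ => gwMeasure ν)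
        (fun w => ∑ j ∈ (Finset.range k).erase i,
          C (Z (w i) * Z' (w j)) * ∏ a ∈ Finset.range k, sizeMonomial (w a)) =
        C ((k - 1 : ℕ) : ℝ≥0∞) *
          (treeSeries ν ^ (k - 2) * (sizeSeries ν Z * sizeSeries ν Z')) := by
      intro i hi
      rw [expSeries_sum _ _ (hQij k i), Finset.sum_congr rfl fun j hj =>
        expSeries_forest_two ν hZ hZ' hi hj, Finset.sum_const, Finset.card_erase_of_mem hi,
        Finset.card_range, nsmul_eq_mul, map_natCast]
      ring
    rw [Finset.sum_congr rfl h3]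
    simp [mul_assoc]
  rw [h1]
  congr 1
  ext n
  rw [coeff_expSeries_gwMeasure ν hQm, coeff_comp_mul, tsum_eq_zero_add' ENNReal.summable,
    tsum_eq_zero_add' ENNReal.summable]
  simp only [h2, coeff_C_mul, coeff_derivative, offspringSeries, coeff_mk]
  have h4 : ∀ k : ℕ, k + 1 + 1 - 2 = k := fun k => by omega
  simp only [Nat.cast_zero, zero_mul, mul_zero, zero_add, Nat.add_sub_cancel, h4, Nat.sub_self]
  refine tsum_congr fun k => ?_
  push_cast
  ring

/-- Each vertex on the path down to generation `l` costs `X G'(T)`, and the subtree at its end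
contributes `T`. -/
lemma sizeSeries_genSize (l : ℕ) : sizeSeries ν (genSize l) =
    X ^ l * comp (X * d⁄dX ℝ≥0∞ (offspringSeries ν) ^ l) (treeSeries ν) := by
  induction l with
  | zero =>
    have : genSize 0 = fun _ => 1 := funext genSize_zero
    rw [this, sizeSeries_one]
    simp [comp_X]
  | succ l ih =>
    have : genSize (l + 1) = fun ξ => ∑ i ∈ Finset.range (ξ []), genSize l (child ξ i) :=
      funext (genSize_succ l)
    rw [this, sizeSeries_sum ν (measurable_genSize l), ih]
    simp only [comp_mul, comp_pow]
    ring

/-- The first generation decomposition of the pairs. -/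
lemma sizeSeries_numPairs (l m : ℕ) : sizeSeries ν (numPairs l m) =
    sizeSeries ν (numRootPairs l m) *
      geom (comp (d⁄dX ℝ≥0∞ (offspringSeries ν)) (treeSeries ν)) := by
  refine eq_mul_geom ?_
  rw [← sizeSeries_sum ν (measurable_numPairs l m)]
  -- The sum over children comes first because additivity of the expectation needs only the first
  -- summand to be measurable.
  have h : numPairs l m = fun ξ => (∑ i ∈ Finset.range (ξ []), numPairs l m (child ξ i))
      + numRootPairs l m ξ := funext fun ξ => by rw [numPairs_eq_add, add_comm]
  have hm : Measurable fun ξ : List ℕ → ℕ =>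
      ∑ i ∈ Finset.range (ξ []), numPairs l m (child ξ i) := by
    have : (fun ξ : List ℕ → ℕ => ∑ i ∈ Finset.range (ξ []), numPairs l m (child ξ i)) =
        fun ξ => ∑' i, if i < ξ [] then numPairs l m (child ξ i) else 0 :=
      funext fun ξ => (tsum_ite_lt _ _).symm
    rw [this]
    exact Measurable.tsum fun i => Measurable.ite
      (measurableSet_lt measurable_const (measurable_pi_apply _))
      ((measurable_numPairs l m).comp (measurable_child i)) measurable_const
  nth_rw 1 [h]
  rw [sizeSeries, add_comm (sizeSeries ν (numRootPairs l m))]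
  simp only [map_add, add_mul]
  exact expSeries_add _ (measurableCoeff_sizeMonomial.C_mul hm)

/-- Lagrange inversion turns the geometric factor into a power of `G` and removes the tree series
altogether; `X^r` only shifts the index. -/
lemma coeff_sizeSeries_numPairs_of {l m r : ℕ} {A : ℝ≥0∞⟦X⟧}
    (h : sizeSeries ν (numRootPairs l m) = X ^ r * comp A (treeSeries ν)) (n : ℕ) :
    coeff n (sizeSeries ν (numPairs l m)) =
      if r ≤ n then coeff (n - r) (A * offspringSeries ν ^ (n - r)) else 0 := by
  rw [sizeSeries_numPairs, h, mul_assoc, coeff_X_pow_mul']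
  split_ifs with hr
  · exact coeff_comp_mul_geom (treeSeries_eq ν) _ _
  · rfl

/-- The law of the total size, in the size-biased form `n P(|T| = n) = P(S_n = n - 1)`. -/
lemma coeff_sizeSeries_numPairs_zero (n : ℕ) :
    coeff n (sizeSeries ν (numPairs 0 0)) = coeff n (X * offspringSeries ν ^ n) := by
  rw [coeff_sizeSeries_numPairs_of ν (r := 0) (A := X), if_pos (Nat.zero_le n), Nat.sub_zero]
  rw [pow_zero, one_mul, comp_X, ← sizeSeries_one]
  rfl

/-- The number of pairs in a tree with `n` vertices as a coefficient of a power series in the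
generating function of the offspring law. -/
lemma coeff_sizeSeries_numPairs (l m : ℕ) : ∃ A : ℝ≥0∞⟦X⟧, ∃ r s : ℕ, r ≤ s + 1 ∧
    (A = X ∨ A = X ^ 2 * d⁄dX ℝ≥0∞ (d⁄dX ℝ≥0∞ (offspringSeries ν))) ∧
    ∀ n, coeff n (sizeSeries ν (numPairs l m)) = if r ≤ n then
      coeff (n - r) (A * d⁄dX ℝ≥0∞ (offspringSeries ν) ^ s * offspringSeries ν ^ (n - r)) else 0 := by
  rcases l with _ | l
  · refine ⟨X, m, m, by omega, Or.inl rfl, coeff_sizeSeries_numPairs_of ν ?_⟩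
    rw [← sizeSeries_genSize]
    congr 1
    funext ξ
    cases m <;> simp [numRootPairs, genSize_zero]
  rcases m with _ | m
  · refine ⟨X, l + 1, l + 1, by omega, Or.inl rfl, coeff_sizeSeries_numPairs_of ν ?_⟩
    rw [← sizeSeries_genSize]
    congr 1
  · refine ⟨_, l + m + 1, l + m, by omega, Or.inr rfl, coeff_sizeSeries_numPairs_of ν ?_⟩
    have : numRootPairs (l + 1) (m + 1) = fun ξ => ∑ i ∈ Finset.range (ξ []),
      ∑ j ∈ (Finset.range (ξ [])).erase i, genSize l (child ξ i) * genSize m (child ξ j) := by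
      funext ξ
      rw [numRootPairs]
    rw [this, sizeSeries_sum_sum ν (measurable_genSize l) (measurable_genSize m),
      sizeSeries_genSize, sizeSeries_genSize]
    simp only [comp_mul, comp_pow, comp_X]
    ring

lemma numPairs_zero_of_mem_sizeEvent {ξ : List ℕ → ℕ} {n : ℕ} (h : ξ ∈ sizeEvent n) :
    numPairs 0 0 ξ = n := by
  classical
  have hlca : ∀ v, lastCommonAncestor v v = v := fun v => by
    induction v with
    | nil => rfl
    | cons a v ih => simp [lastCommonAncestor, ih]
  have h1 : numPairs 0 0 ξ = (((familyTree ξ).encard : ℕ∞) : ℝ≥0∞) := by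
    rw [toENNReal_encard, numPairs]
    refine tsum_congr fun v => ?_
    rw [tsum_eq_single v]
    · simp [hlca]
    · intro w hw
      rw [if_neg]
      rintro ⟨-, -, h1, h2⟩
      have h3 := (lastCommonAncestor_prefix_left v w).eq_of_length (by simpa using h1.symm)
      have h4 := (lastCommonAncestor_prefix_right v w).eq_of_length (by simpa using h2.symm)
      exact hw (h4.symm.trans h3)
  have h2 : (familyTree ξ).encard = n := h
  rw [h1, h2, ENat.toENNReal_coe]

lemma natCast_mul_gwMeasure_sizeEvent (n : ℕ) :
    (n : ℝ≥0∞) * gwMeasure ν (sizeEvent n) = coeff n (X * offspringSeries ν ^ n) := by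
  rw [← coeff_sizeSeries_numPairs_zero, coeff_sizeSeries,
    setLIntegral_congr_fun (measurableSet_sizeEvent n) fun ξ hξ => numPairs_zero_of_mem_sizeEvent hξ,
    setLIntegral_const]

end GaltonWatson

/-! ### Fourier inversion for sums of independent offspring numbers -/

namespace GaltonWatson

open PowerSeries

variable (ν : Measure ℕ)

/-- The generating function of the offspring law, with coefficients in `ℝ≥0`. -/
noncomputable def offspringNN : ℝ≥0⟦X⟧ := PowerSeries.mk fun k => (ν {k}).toNNReal

lemma coeff_offspringNN (k : ℕ) : ((coeff k (offspringNN ν) : ℝ≥0) : ℝ) = ν.real {k} := by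
  simp [offspringNN, Measure.real, ENNReal.toReal]

lemma dvd_of_coeff_pow_ne_zero {d : ℕ} (hd : ∀ k, ν {k} ≠ 0 → d ∣ k) (n : ℕ) {k : ℕ}
    (h : coeff k (offspringNN ν ^ n) ≠ 0) : d ∣ k := by
  induction n generalizing k with
  | zero =>
    have : k = 0 := by
      by_contra hk
      simp [coeff_one, hk] at h
    simp [this]
  | succ n ih =>
    rw [pow_succ, coeff_mul] at h
    obtain ⟨p, hp, hne⟩ := Finset.exists_ne_zero_of_sum_ne_zero h
    rw [← Finset.HasAntidiagonal.mem_antidiagonal.mp hp]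
    refine dvd_add (ih (left_ne_zero_of_mul hne)) (hd _ fun h0 => right_ne_zero_of_mul hne ?_)
    simp [offspringNN, h0]

variable [IsProbabilityMeasure ν]

lemma map_offspringNN : map ENNReal.ofNNRealHom (offspringNN ν) = offspringSeries ν := by
  ext k
  simp [offspringNN, offspringSeries]

lemma coeff_offspringSeries_pow (n k : ℕ) :
    coeff k (offspringSeries ν ^ n) = ((coeff k (offspringNN ν ^ n) : ℝ≥0) : ℝ≥0∞) := by
  rw [← map_offspringNN, ← map_pow, coeff_map]
  rfl

lemma hasSum_real_singleton : HasSum (fun k : ℕ => ν.real {k}) 1 := by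
  have h := hasSum_integral_iUnion (μ := ν) (s := fun k : ℕ => {k}) (f := fun _ => (1 : ℝ))
    (fun _ => measurableSet_singleton _)
    (fun i j h => by simpa [Function.onFun] using h) (integrable_const _).integrableOn
  rw [Set.iUnion_of_singleton] at h
  simpa [Measure.real] using h

/-- The characteristic function of the offspring law. -/
noncomputable def offspringChar (t : ℝ) : ℂ := charFun (ν.map fun k : ℕ => (k : ℝ)) t

lemma continuous_offspringChar : Continuous (offspringChar ν) := by
  have : IsProbabilityMeasure (ν.map fun k : ℕ => (k : ℝ)) :=
    Measure.isProbabilityMeasure_map (by fun_prop)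
  exact continuous_charFun

lemma offspringChar_eq (t : ℝ) :
    offspringChar ν t = ∑' k : ℕ, (ν.real {k} : ℂ) * Complex.exp (t * Complex.I) ^ k := by
  rw [offspringChar, charFun_apply_real, integral_map (by fun_prop) (by fun_prop),
    integral_countable]
  · refine tsum_congr fun k => ?_
    rw [← Complex.exp_nat_mul, Complex.real_smul]
    congr 2
    push_cast
    ring
  · refine (integrable_const (1 : ℝ)).mono' (by fun_prop) (Filter.Eventually.of_forall fun k => ?_)
    have : ((t : ℂ) * ((k : ℝ) : ℂ) * Complex.I) = ((t * k : ℝ) : ℂ) * Complex.I := by push_cast; ring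
    rw [this, Complex.norm_exp_ofReal_mul_I]

/-- Cauchy products of absolutely convergent series, by induction on `n`. -/
lemma summable_coeff_pow_and_tsum (n : ℕ) {z : ℂ} (hz : ‖z‖ ≤ 1) :
    (Summable fun k => ‖((coeff k (offspringNN ν ^ n) : ℝ≥0) : ℂ) * z ^ k‖) ∧
    ∑' k, ((coeff k (offspringNN ν ^ n) : ℝ≥0) : ℂ) * z ^ k =
      (∑' k, (ν.real {k} : ℂ) * z ^ k) ^ n := by
  have h1 : Summable fun k => ‖(ν.real {k} : ℂ) * z ^ k‖ := by
    refine Summable.of_nonneg_of_le (fun _ => norm_nonneg _) (fun k => ?_)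
      (hasSum_real_singleton ν).summable
    rw [norm_mul, norm_pow, Complex.norm_real, Real.norm_of_nonneg measureReal_nonneg]
    exact mul_le_of_le_one_right measureReal_nonneg (pow_le_one₀ (norm_nonneg _) hz)
  induction n with
  | zero =>
    have h0 : ∀ k, k ≠ 0 → ((coeff k (offspringNN ν ^ 0) : ℝ≥0) : ℂ) * z ^ k = 0 := by
      intro k hk
      simp [coeff_one, hk]
    refine ⟨summable_of_ne_finset_zero (s := {0}) fun k hk => ?_, ?_⟩
    · rw [h0 k (by simpa using hk), norm_zero]
    · rw [tsum_eq_single 0 h0]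
      simp
  | succ n ih =>
    obtain ⟨f, hf⟩ : ∃ f : ℕ → ℂ, f = fun k =>
      ((coeff k (offspringNN ν ^ n) : ℝ≥0) : ℂ) * z ^ k := ⟨_, rfl⟩
    obtain ⟨g, hg⟩ : ∃ g : ℕ → ℂ, g = fun k => (ν.real {k} : ℂ) * z ^ k := ⟨_, rfl⟩
    have h2 : ∀ k, ((coeff k (offspringNN ν ^ (n + 1)) : ℝ≥0) : ℂ) * z ^ k =
        ∑ kl ∈ Finset.HasAntidiagonal.antidiagonal k, f kl.1 * g kl.2 := by
      intro k
      simp only [hf, hg]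
      rw [pow_succ, coeff_mul]
      push_cast
      rw [Finset.sum_mul]
      refine Finset.sum_congr rfl fun p hp => ?_
      rw [← Finset.HasAntidiagonal.mem_antidiagonal.mp hp, pow_add, ← coeff_offspringNN]
      ring
    have hf1 : Summable fun k => ‖f k‖ := by simpa only [hf] using ih.1
    have hg1 : Summable fun k => ‖g k‖ := by simpa only [hg] using h1
    have hf2 : ∑' k, f k = (∑' k, g k) ^ n := by simpa only [hf, hg] using ih.2
    simp only [h2]
    refine ⟨summable_norm_sum_mul_antidiagonal_of_summable_norm hf1 hg1, ?_⟩
    rw [← tsum_mul_tsum_eq_tsum_sum_antidiagonal_of_summable_norm hf1 hg1, hf2, ← pow_succ, hg]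

/-- The frequency is a multiple of `d`, so the interval of length `2π/d` is a whole number of
periods. Working there avoids the other points where a lattice law has characteristic function of
modulus `1`. -/
lemma integral_exp_of_dvd {d : ℕ} (hd : 0 < d) {j : ℤ} (hj : (d : ℤ) ∣ j) :
    ∫ t in (-(Real.pi / d))..(Real.pi / d), Complex.exp (j * Complex.I * t) =
      if j = 0 then ((2 * Real.pi / d : ℝ) : ℂ) else 0 := by
  split_ifs with h
  · simp [h]
    ring
  · have hc : (j * Complex.I : ℂ) ≠ 0 := mul_ne_zero (by exact_mod_cast h) Complex.I_ne_zero
    rw [integral_exp_mul_complex hc]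
    obtain ⟨k, rfl⟩ := hj
    have hd' : (d : ℂ) ≠ 0 := by exact_mod_cast hd.ne'
    have : Complex.exp (((d * k : ℤ) : ℂ) * Complex.I * ((Real.pi / d : ℝ) : ℂ)) =
        Complex.exp (((d * k : ℤ) : ℂ) * Complex.I * ((-(Real.pi / d) : ℝ) : ℂ)) := by
      rw [Complex.exp_eq_exp_iff_exists_int]
      refine ⟨k, ?_⟩
      push_cast
      field_simp
      ring
    rw [this, sub_self, zero_div]

/-- Fourier inversion for the coefficients of the powers of the offspring series. -/
lemma integral_offspringChar_pow {d : ℕ} (hd0 : 0 < d) (hd : ∀ k, ν {k} ≠ 0 → d ∣ k) (n : ℕ)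
    {x : ℕ} (hx : d ∣ x) :
    ∫ t in (-(Real.pi / d))..(Real.pi / d),
      offspringChar ν t ^ n * Complex.exp (-(x * Complex.I * t)) =
      ((2 * Real.pi / d * coeff x (offspringNN ν ^ n) : ℝ) : ℂ) := by
  set a : ℕ → ℝ := fun k => ((coeff k (offspringNN ν ^ n) : ℝ≥0) : ℝ) with ha
  set F : ℕ → ℝ → ℂ := fun k t => (a k : ℂ) * Complex.exp (((k : ℤ) - (x : ℤ) : ℤ) * Complex.I * t)
    with hF
  have hle : -(Real.pi / d) ≤ Real.pi / d := by
    have : 0 ≤ Real.pi / d := by positivity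
    linarith
  have hsum : ∀ t : ℝ, offspringChar ν t ^ n * Complex.exp (-(x * Complex.I * t)) = ∑' k, F k t := by
    intro t
    have hz : ‖Complex.exp (t * Complex.I)‖ ≤ 1 := (Complex.norm_exp_ofReal_mul_I t).le
    rw [offspringChar_eq, ← (summable_coeff_pow_and_tsum ν n hz).2, ← tsum_mul_right]
    refine tsum_congr fun k => ?_
    rw [hF, ← Complex.exp_nat_mul, mul_assoc, ← Complex.exp_add]
    simp only [ha]
    congr 2
    push_cast
    ring
  have ha_sum : Summable a := by
    have := (summable_coeff_pow_and_tsum ν n (z := 1) (by simp)).1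
    simpa [ha] using this
  have hnorm : ∀ k t, ‖F k t‖ = a k := by
    intro k t
    have : ((((k : ℤ) - (x : ℤ) : ℤ) : ℂ) * Complex.I * t)
        = ((((k : ℤ) - (x : ℤ) : ℤ) : ℝ) * t : ℝ) * Complex.I := by
      push_cast; ring
    rw [hF]
    simp only
    rw [norm_mul, this, Complex.norm_exp_ofReal_mul_I, mul_one, Complex.norm_real,
      Real.norm_of_nonneg (NNReal.coe_nonneg _)]
  have hint := hasSum_integral_of_summable_integral_norm
    (μ := volume.restrict (Set.Ioc (-(Real.pi / d)) (Real.pi / d))) (F := F)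
    (fun k => by
      have : Continuous (F k) := by fun_prop
      exact (this.integrableOn_Icc).mono_set Set.Ioc_subset_Icc_self)
    (by
      simp only [hnorm, integral_const, smul_eq_mul]
      exact ha_sum.mul_left _)
  simp only [hsum]
  rw [intervalIntegral.integral_of_le hle, ← hint.tsum_eq]
  have hterm : ∀ k, ∫ t in Set.Ioc (-(Real.pi / d)) (Real.pi / d), F k t =
      if k = x then ((2 * Real.pi / d * a x : ℝ) : ℂ) else 0 := by
    intro k
    rw [← intervalIntegral.integral_of_le hle]
    simp only [hF]
    rw [intervalIntegral.integral_const_mul]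
    by_cases hk : a k = 0
    · rw [hk]
      split_ifs with h
      · subst h; simp [hk]
      · simp
    · have hdk : d ∣ k := dvd_of_coeff_pow_ne_zero ν hd n fun h => hk (by simp [ha, h])
      rw [integral_exp_of_dvd hd0
        (dvd_sub (Int.natCast_dvd_natCast.mpr hdk) (Int.natCast_dvd_natCast.mpr hx))]
      by_cases h : k = x
      · subst h
        simp [mul_comm]
      · have : ((k : ℤ) - (x : ℤ)) ≠ 0 := by omega
        rw [if_neg this, if_neg h, mul_zero]
  simp only [hterm]
  rw [tsum_ite_eq]

end GaltonWatson

/-! ### Decay of the characteristic function -/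

namespace GaltonWatson

open PowerSeries

/-- With `u = ab(1 - cos θ)`, the squared norm is `(a+b)² - 2u`, which is at most `(a+b-u)²` because
`a + b ≤ 1`. -/
lemma norm_add_mul_exp_le {a b : ℝ} (ha : 0 ≤ a) (hb : 0 ≤ b) (hab : a + b ≤ 1) (θ : ℝ) :
    ‖(a : ℂ) + b * Complex.exp (θ * Complex.I)‖ ≤ a + b - a * b * (1 - Real.cos θ) := by
  have hc1 := Real.cos_le_one θ
  have hc2 := Real.neg_one_le_cos θ
  have hsc := Real.sin_sq_add_cos_sq θ
  have hnn : 0 ≤ a + b - a * b * (1 - Real.cos θ) := by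
    have h1 : a * b * (1 - Real.cos θ) ≤ a * b * 2 :=
      mul_le_mul_of_nonneg_left (by linarith) (mul_nonneg ha hb)
    nlinarith
  refine le_of_sq_le_sq ?_ hnn
  have hsq : ‖(a : ℂ) + b * Complex.exp (θ * Complex.I)‖ ^ 2 =
      (a + b) ^ 2 - 2 * (a * b * (1 - Real.cos θ)) := by
    have hz : (a : ℂ) + b * Complex.exp (θ * Complex.I) =
        ((a + b * Real.cos θ : ℝ) : ℂ) + ((b * Real.sin θ : ℝ) : ℂ) * Complex.I := by
      rw [Complex.exp_mul_I]
      push_cast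
      ring
    rw [hz, Complex.sq_norm, Complex.normSq_add_mul_I]
    linear_combination b ^ 2 * hsc
  rw [hsq]
  have hu : 0 ≤ a * b * (1 - Real.cos θ) := mul_nonneg (mul_nonneg ha hb) (by linarith)
  nlinarith [sq_nonneg (a * b * (1 - Real.cos θ))]

variable (ν : Measure ℕ)

/-- The span of the offspring law: a generator of the group generated by the support. -/
lemma exists_span {k₀ : ℕ} (hk₀ : k₀ ≠ 0) (h : ν {k₀} ≠ 0) : ∃ d : ℕ, 0 < d ∧
    (∀ k, ν {k} ≠ 0 → d ∣ k) ∧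
    (d : ℤ) ∈ AddSubgroup.closure {z : ℤ | ∃ k : ℕ, ν {k} ≠ 0 ∧ z = k} := by
  obtain ⟨a, ha⟩ := Int.subgroup_cyclic (AddSubgroup.closure {z : ℤ | ∃ k : ℕ, ν {k} ≠ 0 ∧ z = k})
  have hdvd : ∀ k, ν {k} ≠ 0 → a.natAbs ∣ k := by
    intro k hk
    have h1 : (k : ℤ) ∈ AddSubgroup.closure {a} := by
      rw [← ha]
      exact AddSubgroup.subset_closure ⟨k, hk, rfl⟩
    rw [AddSubgroup.mem_closure_singleton] at h1
    obtain ⟨n, hn⟩ := h1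
    rw [← Int.natCast_dvd_natCast, Int.natCast_natAbs, abs_dvd]
    exact ⟨n, by rw [← hn, smul_eq_mul, mul_comm]⟩
  refine ⟨a.natAbs, ?_, hdvd, ?_⟩
  · rcases Nat.eq_zero_or_pos a.natAbs with h0 | h0
    · have := hdvd k₀ h
      rw [h0, zero_dvd_iff] at this
      exact absurd this hk₀
    · exact h0
  · rw [ha, AddSubgroup.mem_closure_singleton]
    rcases Int.natAbs_eq a with h0 | h0
    · exact ⟨1, by rw [one_smul]; exact h0⟩
    · exact ⟨-1, by rw [neg_smul, one_smul]; omega⟩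

variable [IsProbabilityMeasure ν]

/-- The atoms `0` and `j` are kept together to exploit their cancellation; the rest is bounded by
its mass. -/
lemma norm_offspringChar_le {j : ℕ} (hj : j ≠ 0) (t : ℝ) :
    ‖offspringChar ν t‖ ≤ 1 - ν.real {0} * ν.real {j} * (1 - Real.cos (j * t)) := by
  have hp := hasSum_real_singleton ν
  set f : ℕ → ℂ := fun k => (ν.real {k} : ℂ) * Complex.exp (t * Complex.I) ^ k with hf
  have hfn : ∀ k, ‖f k‖ = ν.real {k} := by
    intro k
    simp only [hf]
    rw [norm_mul, norm_pow, Complex.norm_exp_ofReal_mul_I, one_pow, mul_one, Complex.norm_real,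
      Real.norm_of_nonneg measureReal_nonneg]
  have hfs : Summable fun k => ‖f k‖ := by simpa only [hfn] using hp.summable
  have h1 := (hfs.of_norm).sum_add_tsum_compl (s := {0, j})
  have h2 := hp.summable.sum_add_tsum_compl (s := {0, j})
  rw [Finset.sum_pair hj.symm] at h1 h2
  rw [hp.tsum_eq] at h2
  have h3 : ‖∑' k : ↑((({0, j} : Finset ℕ) : Set ℕ)ᶜ), f k‖ ≤
      ∑' k : ↑((({0, j} : Finset ℕ) : Set ℕ)ᶜ), ν.real {(k : ℕ)} := by
    refine (norm_tsum_le_tsum_norm (hfs.subtype _)).trans (le_of_eq (tsum_congr fun k => hfn k))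
  have h4 : (0 : ℝ) ≤ ∑' k : ↑((({0, j} : Finset ℕ) : Set ℕ)ᶜ), ν.real {(k : ℕ)} :=
    tsum_nonneg fun _ => measureReal_nonneg
  have h5 := norm_add_mul_exp_le (a := ν.real {0}) (b := ν.real {j}) measureReal_nonneg
    measureReal_nonneg (by linarith) (j * t)
  have h6 : f 0 + f j = (ν.real {0} : ℂ) + (ν.real {j} : ℂ) *
      Complex.exp (((j * t : ℝ) : ℂ) * Complex.I) := by
    simp only [hf]
    rw [← Complex.exp_nat_mul _ j]
    push_cast
    rw [pow_zero, mul_one, mul_assoc (j : ℂ)]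
  rw [offspringChar_eq, ← h1]
  refine (norm_add_le _ _).trans ?_
  rw [h6]
  linarith

/-- Modulus `1` would force `kt ∈ 2πℤ` for every atom `k`, hence `dt ∈ 2πℤ` since `d` lies in the
group they generate; but `0 < |dt| ≤ π`. -/
lemma norm_offspringChar_lt_one (h0 : ν {0} ≠ 0) {d : ℕ} (hd0 : 0 < d)
    (hd : (d : ℤ) ∈ AddSubgroup.closure {z : ℤ | ∃ k : ℕ, ν {k} ≠ 0 ∧ z = k}) {t : ℝ}
    (ht : |t| ≤ Real.pi / d) (ht0 : t ≠ 0) : ‖offspringChar ν t‖ < 1 := by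
  by_contra hcon
  have hreal : ∀ k, ν {k} ≠ 0 → 0 < ν.real {k} := fun k hk =>
    ENNReal.toReal_pos hk (measure_ne_top _ _)
  have hcos : ∀ k : ℕ, ν {k} ≠ 0 → Real.cos (k * t) = 1 := by
    intro k hk
    rcases eq_or_ne k 0 with rfl | hk0
    · simp
    have h1 := norm_offspringChar_le ν hk0 t
    have h2 : 0 < ν.real {0} * ν.real {k} := mul_pos (hreal 0 h0) (hreal k hk)
    have h3 := Real.cos_le_one (k * t)
    refine le_antisymm h3 ?_
    by_contra h4
    have := mul_pos h2 (sub_pos.mpr (not_le.mp h4))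
    linarith
  have hsub : ∀ z ∈ AddSubgroup.closure {z : ℤ | ∃ k : ℕ, ν {k} ≠ 0 ∧ z = k},
      ∃ n : ℤ, (n : ℝ) * (2 * Real.pi) = z * t := by
    intro z hz
    induction hz using AddSubgroup.closure_induction with
    | mem z hz =>
      obtain ⟨k, hk, rfl⟩ := hz
      have := (Real.cos_eq_one_iff _).mp (hcos k hk)
      simpa using this
    | zero => exact ⟨0, by simp⟩
    | add x y _ _ hx hy =>
      obtain ⟨n, hn⟩ := hx
      obtain ⟨m, hm⟩ := hy
      exact ⟨n + m, by push_cast; rw [add_mul, hn, hm, add_mul]⟩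
    | neg x _ hx =>
      obtain ⟨n, hn⟩ := hx
      exact ⟨-n, by push_cast; rw [neg_mul, hn, neg_mul]⟩
  obtain ⟨n, hn⟩ := hsub d hd
  have hdpos : (0 : ℝ) < d := by exact_mod_cast hd0
  have h1 : |(n : ℝ)| * (2 * Real.pi) ≤ Real.pi := by
    have h2 : |(n : ℝ) * (2 * Real.pi)| = d * |t| := by
      rw [hn, abs_mul]; simp
    rw [abs_mul, abs_of_pos (by positivity : (0 : ℝ) < 2 * Real.pi)] at h2
    rw [h2]
    calc (d : ℝ) * |t| ≤ d * (Real.pi / d) := by gcongr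
      _ = Real.pi := by field_simp
  have h3 : n = 0 := by
    by_contra hne
    have h4 : (1 : ℝ) ≤ |(n : ℝ)| := by
      rw [← Int.cast_abs]
      exact_mod_cast Int.one_le_abs hne
    nlinarith [Real.pi_pos]
  rw [h3] at hn
  simp at hn
  rcases hn with hn | hn
  · omega
  · exact ht0 hn

/-- Gaussian decay of the characteristic function on a period. -/
lemma exists_norm_offspringChar_le_exp (h0 : ν {0} ≠ 0) {k₀ : ℕ} (hk₀ : k₀ ≠ 0) (h : ν {k₀} ≠ 0)
    {d : ℕ} (hd0 : 0 < d)
    (hd : (d : ℤ) ∈ AddSubgroup.closure {z : ℤ | ∃ k : ℕ, ν {k} ≠ 0 ∧ z = k}) :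
    ∃ c : ℝ, 0 < c ∧ ∀ t : ℝ, |t| ≤ Real.pi / d → ‖offspringChar ν t‖ ≤ Real.exp (-c * t ^ 2) := by
  suffices ∃ c : ℝ, 0 < c ∧ ∀ t : ℝ, |t| ≤ Real.pi / d → ‖offspringChar ν t‖ ≤ 1 - c * t ^ 2 by
    obtain ⟨c, hc, hc'⟩ := this
    refine ⟨c, hc, fun t ht => (hc' t ht).trans ?_⟩
    have := Real.add_one_le_exp (-c * t ^ 2)
    linarith
  have hreal : ∀ k, ν {k} ≠ 0 → 0 < ν.real {k} := fun k hk =>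
    ENNReal.toReal_pos hk (measure_ne_top _ _)
  have hk₀pos : (0 : ℝ) < k₀ := by exact_mod_cast Nat.pos_of_ne_zero hk₀
  have hpi := Real.pi_pos
  -- From `cos x ≤ 1 - 2x²/π²` on `[-π, π]` at `x = k₀ t`. For larger `|t|`, compactness gives a
  -- bound `r < 1`, which `c₂` converts to quadratic form.
  set c₁ : ℝ := ν.real {0} * ν.real {k₀} * (2 / Real.pi ^ 2 * k₀ ^ 2) with hc₁
  have hc₁pos : 0 < c₁ := by
    have := hreal 0 h0
    have := hreal k₀ h
    positivity
  have hnear : ∀ t : ℝ, |t| ≤ Real.pi / k₀ → ‖offspringChar ν t‖ ≤ 1 - c₁ * t ^ 2 := by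
    intro t ht
    refine (norm_offspringChar_le ν hk₀ t).trans ?_
    have h1 : |(k₀ : ℝ) * t| ≤ Real.pi := by
      rw [abs_mul, abs_of_pos hk₀pos]
      calc (k₀ : ℝ) * |t| ≤ k₀ * (Real.pi / k₀) := by gcongr
        _ = Real.pi := by field_simp
    have h2 := Real.cos_le_one_sub_mul_cos_sq h1
    have h3 : ν.real {0} * ν.real {k₀} * (2 / Real.pi ^ 2 * (k₀ * t) ^ 2) ≤
        ν.real {0} * ν.real {k₀} * (1 - Real.cos (k₀ * t)) := by
      gcongr
      linarith
    have h4 : c₁ * t ^ 2 = ν.real {0} * ν.real {k₀} * (2 / Real.pi ^ 2 * (k₀ * t) ^ 2) := by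
      rw [hc₁]; ring
    linarith
  set K : Set ℝ := Set.Icc (-(Real.pi / d)) (Real.pi / d) ∩ {t | Real.pi / k₀ ≤ |t|} with hK
  have hKc : IsCompact K :=
    isCompact_Icc.inter_right (isClosed_le continuous_const continuous_abs)
  have hfar : ∃ r : ℝ, r < 1 ∧ ∀ t ∈ K, ‖offspringChar ν t‖ ≤ r := by
    rcases K.eq_empty_or_nonempty with hKe | hKn
    · exact ⟨0, one_pos, fun t ht => by simp [hKe] at ht⟩
    · obtain ⟨s, hs, hmax⟩ := hKc.exists_isMaxOn hKn
        (continuous_offspringChar ν).norm.continuousOn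
      refine ⟨_, norm_offspringChar_lt_one ν h0 hd0 hd (abs_le.mpr hs.1) ?_, fun t ht => hmax ht⟩
      rintro rfl
      have : Real.pi / k₀ ≤ |(0 : ℝ)| := hs.2
      rw [abs_zero] at this
      exact absurd this (not_le.mpr (by positivity))
  obtain ⟨r, hr, hfar⟩ := hfar
  have hdpos : (0 : ℝ) < d := by exact_mod_cast hd0
  set c₂ : ℝ := (1 - r) / (Real.pi / d) ^ 2 with hc₂
  have hc₂pos : 0 < c₂ := by
    have : 0 < 1 - r := by linarith
    positivity
  refine ⟨min c₁ c₂, lt_min hc₁pos hc₂pos, fun t ht => ?_⟩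
  rcases le_total |t| (Real.pi / k₀) with h1 | h1
  · refine (hnear t h1).trans ?_
    have : min c₁ c₂ * t ^ 2 ≤ c₁ * t ^ 2 := by gcongr; exact min_le_left _ _
    linarith
  · refine (hfar t ⟨abs_le.mp ht, h1⟩).trans ?_
    have h2 : min c₁ c₂ * t ^ 2 ≤ c₂ * (Real.pi / d) ^ 2 := by
      rw [← sq_abs t]
      gcongr
      exact min_le_right _ _
    have h3 : c₂ * (Real.pi / d) ^ 2 = 1 - r := by
      rw [hc₂]; field_simp
    linarith

end GaltonWatson

/-! ### Local limit estimates -/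

namespace GaltonWatson

open PowerSeries

open Filter Topology

variable {ν : Measure ℕ}

lemma IsCriticalOffspring.not_ae_eq_one (hν : IsCriticalOffspring ν) :
    ¬ ∀ᵐ k : ℕ ∂ν, (k : ℝ) - 1 = 0 := by
  intro h
  have h1 := hν.variance_pos
  rw [variance_eq_integral (by fun_prop), hν.mean_eq_one] at h1
  have h2 : ∫ k : ℕ, ((k : ℝ) - 1) ^ 2 ∂ν = 0 :=
    integral_eq_zero_of_ae (h.mono fun k hk => by simp [hk])
  linarith

lemma norm_offspringChar_pow_le {c t : ℝ} (h : ‖offspringChar ν t‖ ≤ Real.exp (-c * t ^ 2)) (n x : ℕ) :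
    ‖offspringChar ν t ^ n * Complex.exp (-(x * Complex.I * t))‖ ≤
      Real.exp (-(c * n) * t ^ 2) := by
  have h1 : (-(x * Complex.I * t) : ℂ) = ((-(x * t) : ℝ) : ℂ) * Complex.I := by
    push_cast; ring
  rw [norm_mul, norm_pow, h1, Complex.norm_exp_ofReal_mul_I, mul_one]
  calc ‖offspringChar ν t‖ ^ n ≤ Real.exp (-c * t ^ 2) ^ n := by gcongr
    _ = Real.exp (-(c * n) * t ^ 2) := by rw [← Real.exp_nat_mul]; ring_nf

variable [IsProbabilityMeasure ν]

lemma IsCriticalOffspring.integrable (hν : IsCriticalOffspring ν) :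
    Integrable (fun k : ℕ => (k : ℝ)) ν :=
  hν.memLp_two.integrable one_le_two

/-- Otherwise `ξ - 1 ≥ 0` almost surely with mean zero, so `ξ = 1`, contradicting positive variance.
-/
lemma IsCriticalOffspring.measure_zero_ne_zero (hν : IsCriticalOffspring ν) : ν {0} ≠ 0 := by
  intro h0
  have hnn : ∀ᵐ k : ℕ ∂ν, 0 ≤ (k : ℝ) - 1 := by
    rw [ae_iff_of_countable]
    intro k hk
    have : 1 ≤ k := Nat.one_le_iff_ne_zero.mpr fun h => hk (h ▸ h0)
    have : (1 : ℝ) ≤ k := by exact_mod_cast this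
    linarith
  have hint : ∫ k : ℕ, ((k : ℝ) - 1) ∂ν = 0 := by
    rw [integral_sub hν.integrable (integrable_const _), hν.mean_eq_one]
    simp
  exact hν.not_ae_eq_one ((integral_eq_zero_iff_of_nonneg_ae hnn
    (hν.integrable.sub (integrable_const _))).mp hint)

lemma IsCriticalOffspring.exists_two_le (hν : IsCriticalOffspring ν) :
    ∃ k, 2 ≤ k ∧ ν {k} ≠ 0 := by
  by_contra! hcon
  have hnn : ∀ᵐ k : ℕ ∂ν, 0 ≤ 1 - (k : ℝ) := by
    rw [ae_iff_of_countable]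
    intro k hk
    have : k ≤ 1 := by
      by_contra h
      exact hk (hcon k (by omega))
    have : (k : ℝ) ≤ 1 := by exact_mod_cast this
    linarith
  have hint : ∫ k : ℕ, (1 - (k : ℝ)) ∂ν = 0 := by
    rw [integral_sub (integrable_const _) hν.integrable, hν.mean_eq_one]
    simp
  have h := (integral_eq_zero_iff_of_nonneg_ae hnn
    ((integrable_const _).sub hν.integrable)).mp hint
  exact hν.not_ae_eq_one (h.mono fun k hk => by
    have : 1 - (k : ℝ) = 0 := hk
    linarith)

/-- The sums of `n` independent offspring numbers have atoms of size `O(n ^ (-1/2))`. -/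
lemma IsCriticalOffspring.exists_coeff_pow_le (hν : IsCriticalOffspring ν) :
    ∃ C : ℝ, 0 < C ∧ ∀ n x : ℕ, 1 ≤ n →
      ((coeff x (offspringNN ν ^ n) : ℝ≥0) : ℝ) ≤ C / √n := by
  obtain ⟨k₀, hk₀, hνk₀⟩ := hν.exists_two_le
  obtain ⟨d, hd0, hd, hdmem⟩ := exists_span ν (by omega) hνk₀
  obtain ⟨c, hc, hbound⟩ := exists_norm_offspringChar_le_exp ν hν.measure_zero_ne_zero
    (by omega) hνk₀ hd0 hdmem
  have hdpos : (0 : ℝ) < d := by exact_mod_cast hd0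
  have hpi := Real.pi_pos
  -- The inversion prefactor `d/(2π)` times the Gaussian integral `√(π/(cn))`, without its `1/√n`.
  refine ⟨d / (2 * Real.pi) * √(Real.pi / c), by positivity, fun n x hn => ?_⟩
  have hnpos : (0 : ℝ) < n := by exact_mod_cast hn
  by_cases hx : d ∣ x
  · have h1 := integral_offspringChar_pow ν hd0 hd n hx
    have hle : -(Real.pi / d) ≤ Real.pi / d := by
      have : 0 ≤ Real.pi / d := by positivity
      linarith
    have hgi := integrable_exp_neg_mul_sq (b := c * n) (by positivity)
    have h2 : ‖∫ t in (-(Real.pi / d))..(Real.pi / d),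
        offspringChar ν t ^ n * Complex.exp (-(x * Complex.I * t))‖ ≤ √(Real.pi / (c * n)) := by
      rw [← integral_gaussian]
      refine (intervalIntegral.norm_integral_le_of_norm_le hle (Eventually.of_forall fun t ht =>
        norm_offspringChar_pow_le (hbound t (abs_le.mpr ⟨ht.1.le, ht.2⟩)) n x)
        hgi.intervalIntegrable).trans ?_
      rw [intervalIntegral.integral_of_le hle]
      exact setIntegral_le_integral hgi (Eventually.of_forall fun t => (Real.exp_pos _).le)
    rw [h1, Complex.norm_real, Real.norm_of_nonneg (by positivity)] at h2
    have h3 : √(Real.pi / (c * n)) = √(Real.pi / c) / √n := by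
      rw [← div_div, Real.sqrt_div (by positivity)]
    rw [h3] at h2
    calc ((coeff x (offspringNN ν ^ n) : ℝ≥0) : ℝ)
        = d / (2 * Real.pi) * (2 * Real.pi / d * coeff x (offspringNN ν ^ n)) := by field_simp
      _ ≤ d / (2 * Real.pi) * (√(Real.pi / c) / √n) := by gcongr
      _ = _ := by ring
  · have : coeff x (offspringNN ν ^ n) = 0 := by
      by_contra h
      exact hx (dvd_of_coeff_pow_ne_zero ν hd n h)
    rw [this]
    simp only [NNReal.coe_zero]
    positivity

/-- The central limit theorem for `(ξ - 1)/√V`, evaluated at frequency `√V s` to undo the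
normalization. -/
lemma tendsto_offspringChar_pow (hν : IsCriticalOffspring ν) (s : ℝ) :
    Tendsto (fun n : ℕ => offspringChar ν ((√n)⁻¹ * s) ^ n *
        Complex.exp (-(n * Complex.I * ((√n)⁻¹ * s : ℝ)))) atTop
      (𝓝 (Complex.exp (-(Var[fun k : ℕ => (k : ℝ); ν] / 2 : ℝ) * (s : ℂ) ^ 2))) := by
  set V := Var[fun k : ℕ => (k : ℝ); ν] with hV
  have hVpos : 0 < V := hν.variance_pos
  have hσ : 0 < √V := Real.sqrt_pos.mpr hVpos
  have hVint : V = ∫ k : ℕ, ((k : ℝ) - 1) ^ 2 ∂ν := by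
    rw [hV, variance_eq_integral (by fun_prop), hν.mean_eq_one]
  have h := tendsto_charFun_inv_sqrt_mul_pow (P := ν) (X := fun k : ℕ => (√V)⁻¹ * ((k : ℝ) + -1))
    (by fun_prop) (by
      rw [integral_const_mul, integral_add hν.integrable (integrable_const _), hν.mean_eq_one]
      simp) (by
      simp only [Pi.pow_apply, mul_pow, inv_pow, Real.sq_sqrt hVpos.le]
      rw [integral_const_mul]
      simp only [← sub_eq_add_neg]
      rw [← hVint]
      field_simp) (√V * s)
  have h2 : ∀ t : ℝ, charFun (ν.map fun k : ℕ => (√V)⁻¹ * ((k : ℝ) + -1)) (√V * t) =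
      offspringChar ν t * Complex.exp (-(Complex.I * t)) := by
    intro t
    rw [charFun_map_mul_comp (by fun_prop), inv_mul_cancel_left₀ hσ.ne']
    have h3 : (ν.map fun k : ℕ => (k : ℝ) + -1) =
        (ν.map fun k : ℕ => (k : ℝ)).map fun x => x + -1 := by
      rw [Measure.map_map (by fun_prop) (by fun_prop)]
      rfl
    rw [h3, charFun_map_add_const, offspringChar]
    congr 2
    simp
    ring
  convert h using 2 with n
  · have : (√n : ℝ)⁻¹ * (√V * s) = √V * ((√n)⁻¹ * s) := by ring
    rw [this, h2, mul_pow, ← Complex.exp_nat_mul]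
    congr 2
    ring
  · congr 1
    push_cast
    have hV2 : ((√V : ℝ) : ℂ) ^ 2 = V := by rw [← Complex.ofReal_pow, Real.sq_sqrt hVpos.le]
    rw [mul_pow, hV2]
    ring

lemma exists_pos_forall_le {P : ℕ → Prop} {f : ℕ → ℝ} {c : ℝ} (hc : 0 < c)
    (hf : ∀ n, P n → 0 < f n) (hev : ∀ᶠ n in atTop, P n → c ≤ f n) :
    ∃ c' : ℝ, 0 < c' ∧ ∀ n, P n → c' ≤ f n := by
  obtain ⟨N, hN⟩ := eventually_atTop.mp hev
  have hfin : ∀ N : ℕ, ∃ c' : ℝ, 0 < c' ∧ ∀ n < N, P n → c' ≤ f n := by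
    intro N
    induction N with
    | zero => exact ⟨1, one_pos, fun n hn => by omega⟩
    | succ N ih =>
      obtain ⟨c', hc', h⟩ := ih
      by_cases hP : P N
      · refine ⟨min c' (f N), lt_min hc' (hf N hP), fun n hn hPn => ?_⟩
        rcases Nat.lt_succ_iff_lt_or_eq.mp hn with h1 | rfl
        · exact (min_le_left _ _).trans (h n h1 hPn)
        · exact min_le_right _ _
      · refine ⟨c', hc', fun n hn hPn => ?_⟩
        rcases Nat.lt_succ_iff_lt_or_eq.mp hn with h1 | rfl
        · exact h n h1 hPn
        · exact absurd hPn hP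
  obtain ⟨c', hc', h⟩ := hfin N
  refine ⟨min c c', lt_min hc hc', fun n hn => ?_⟩
  rcases lt_or_ge n N with h1 | h1
  · exact (min_le_right _ _).trans (h n h1 hn)
  · exact (min_le_left _ _).trans (hN n h1 hn)

/-- The local limit theorem, as a lower bound: `P(S_n = n - 1)` is of order at least `n ^ (-1/2)`
unless it vanishes. -/
lemma IsCriticalOffspring.exists_le_coeff_pow (hν : IsCriticalOffspring ν) :
    ∃ c : ℝ, 0 < c ∧ ∀ n : ℕ, coeff n (offspringNN ν ^ (n + 1)) ≠ 0 →
      c ≤ √(n + 1 : ℕ) * ((coeff n (offspringNN ν ^ (n + 1)) : ℝ≥0) : ℝ) := by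
  obtain ⟨k₀, hk₀, hνk₀⟩ := hν.exists_two_le
  obtain ⟨d, hd0, hd, hdmem⟩ := exists_span ν (by omega) hνk₀
  obtain ⟨c, hc, hbound⟩ := exists_norm_offspringChar_le_exp ν hν.measure_zero_ne_zero
    (by omega) hνk₀ hd0 hdmem
  have hdpos : (0 : ℝ) < d := by exact_mod_cast hd0
  have hpi := Real.pi_pos
  set V := Var[fun k : ℕ => (k : ℝ); ν] with hV
  have hVpos : 0 < V := hν.variance_pos
  set S : Set ℝ := Set.Ioc (-(Real.pi / d)) (Real.pi / d) with hS
  -- The indicator puts the rescaled inversion integrals on the whole line, where the Gaussian decay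
  -- provides one dominating function.
  set g : ℕ → ℝ → ℂ := fun n => S.indicator fun t =>
    offspringChar ν t ^ (n + 1) * Complex.exp (-(n * Complex.I * t)) with hg
  have hgm : ∀ n, Measurable (g n) := fun n =>
    (((continuous_offspringChar ν).pow _).mul (by fun_prop)).measurable.indicator measurableSet_Ioc
  have hsqrt : Tendsto (fun n : ℕ => (√(n + 1 : ℕ))⁻¹) atTop (𝓝 0) :=
    (tendsto_inv_atTop_zero.comp <| Real.tendsto_sqrt_atTop.comp
      tendsto_natCast_atTop_atTop).comp (tendsto_add_atTop_nat 1)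
  have hlim : Tendsto (fun n : ℕ => ∫ s : ℝ, g n ((√(n + 1 : ℕ))⁻¹ * s)) atTop
      (𝓝 (∫ s : ℝ, Complex.exp (-(V / 2 : ℝ) * (s : ℂ) ^ 2))) := by
    refine tendsto_integral_of_dominated_convergence (fun s => Real.exp (-c * s ^ 2))
      (fun n => ((hgm n).comp (measurable_const_mul _)).aestronglyMeasurable)
      (integrable_exp_neg_mul_sq hc) (fun n => Eventually.of_forall fun s => ?_)
      (Eventually.of_forall fun s => ?_)
    · by_cases hs : (√(n + 1 : ℕ))⁻¹ * s ∈ S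
      · simp only [hg]
        rw [Set.indicator_of_mem hs]
        refine (norm_offspringChar_pow_le (hbound _ (abs_le.mpr ⟨hs.1.le, hs.2⟩)) _ _).trans
          (le_of_eq ?_)
        rw [mul_pow, inv_pow, Real.sq_sqrt (Nat.cast_nonneg _)]
        congr 1
        have : ((n + 1 : ℕ) : ℝ) ≠ 0 := by positivity
        field_simp
      · simp only [hg]
        rw [Set.indicator_of_notMem hs, norm_zero]
        exact (Real.exp_pos _).le
    · have hts : Tendsto (fun n : ℕ => (√(n + 1 : ℕ))⁻¹ * s) atTop (𝓝 0) := by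
        simpa using hsqrt.mul_const s
      have hin : ∀ᶠ n : ℕ in atTop, (√(n + 1 : ℕ))⁻¹ * s ∈ S := by
        refine hts.eventually (Ioc_mem_nhds ?_ ?_)
        · have : 0 < Real.pi / d := by positivity
          linarith
        · positivity
      have h1 := (tendsto_offspringChar_pow hν s).comp (tendsto_add_atTop_nat 1)
      -- The target `n` is one less than the mean `n + 1` of the sum; this shift costs a phase
      -- tending to `1`.
      have h2 : Tendsto (fun n : ℕ => Complex.exp (Complex.I * ((√(n + 1 : ℕ))⁻¹ * s : ℝ))) atTop
          (𝓝 1) := by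
        have hcont : Continuous fun t : ℝ => Complex.exp (Complex.I * t) := by fun_prop
        have := (hcont.tendsto 0).comp hts
        simpa [Function.comp_def] using this
      have h3 := h1.mul h2
      rw [mul_one] at h3
      refine h3.congr' (hin.mono fun n hn => ?_)
      simp only [hg, Function.comp]
      rw [Set.indicator_of_mem hn, mul_assoc, ← Complex.exp_add]
      congr 2
      push_cast
      ring
  have hgauss : ∫ s : ℝ, Complex.exp (-(V / 2 : ℝ) * (s : ℂ) ^ 2) =
      ((√(Real.pi / (V / 2)) : ℝ) : ℂ) := by
    rw [← integral_gaussian, ← integral_complex_ofReal]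
    congr 1
    funext s
    push_cast
    rfl
  set L := √(Real.pi / (V / 2)) with hL
  have hLpos : 0 < L := by positivity
  have hval : ∀ n : ℕ, d ∣ n → ‖∫ s : ℝ, g n ((√(n + 1 : ℕ))⁻¹ * s)‖ =
      2 * Real.pi / d * (√(n + 1 : ℕ) * ((coeff n (offspringNN ν ^ (n + 1)) : ℝ≥0) : ℝ)) := by
    intro n hn
    have hle : -(Real.pi / d) ≤ Real.pi / d := by
      have : 0 ≤ Real.pi / d := by positivity
      linarith
    rw [Measure.integral_comp_mul_left, inv_inv, abs_of_nonneg (Real.sqrt_nonneg _)]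
    simp only [hg]
    rw [integral_indicator measurableSet_Ioc, ← intervalIntegral.integral_of_le hle,
      integral_offspringChar_pow ν hd0 hd (n + 1) hn, norm_smul, Complex.norm_real,
      Real.norm_of_nonneg (Real.sqrt_nonneg _), Real.norm_of_nonneg (by positivity)]
    ring
  rw [hgauss] at hlim
  have hev : ∀ᶠ n : ℕ in atTop, L / 2 < ‖∫ s : ℝ, g n ((√(n + 1 : ℕ))⁻¹ * s)‖ := by
    refine hlim.norm.eventually (lt_mem_nhds ?_)
    rw [Complex.norm_real, Real.norm_of_nonneg hLpos.le]
    linarith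
  -- The limit only controls large `n`; the finitely many others are positive by assumption and
  -- lower the constant.
  refine exists_pos_forall_le (c := d / (2 * Real.pi) * (L / 2)) (by positivity) (fun n hn => ?_) ?_
  · have h1 : 0 < coeff n (offspringNN ν ^ (n + 1)) := pos_iff_ne_zero.mpr hn
    have h2 : (0 : ℝ) < ((coeff n (offspringNN ν ^ (n + 1)) : ℝ≥0) : ℝ) := h1
    have h3 : (0 : ℝ) < √(n + 1 : ℕ) := Real.sqrt_pos.mpr (by positivity)
    exact mul_pos h3 h2
  · refine hev.mono fun n hn hne => ?_
    rw [hval n (dvd_of_coeff_pow_ne_zero ν hd _ hne)] at hn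
    calc d / (2 * Real.pi) * (L / 2) ≤ d / (2 * Real.pi) * (2 * Real.pi / d *
          (√(n + 1 : ℕ) * ((coeff n (offspringNN ν ^ (n + 1)) : ℝ≥0) : ℝ))) := by gcongr
      _ = _ := by field_simp

end GaltonWatson

/-! ### Evaluation of power series and the uniform upper bound -/

namespace GaltonWatson

open PowerSeries

open Filter Topology

/-- The value of a power series at a point. -/
noncomputable def evalSeries (A : ℝ≥0∞⟦X⟧) (y : ℝ≥0∞) : ℝ≥0∞ := ∑' j, coeff j A * y ^ j

lemma evalSeries_eq_coeff_comp (A : ℝ≥0∞⟦X⟧) (y : ℝ≥0∞) :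
    evalSeries A y = coeff 0 (comp A (C y)) := by
  simp [evalSeries, comp, ← map_pow]

lemma evalSeries_mul (A B : ℝ≥0∞⟦X⟧) (y : ℝ≥0∞) :
    evalSeries (A * B) y = evalSeries A y * evalSeries B y := by
  simp [evalSeries_eq_coeff_comp, comp_mul]

lemma evalSeries_pow (A : ℝ≥0∞⟦X⟧) (k : ℕ) (y : ℝ≥0∞) :
    evalSeries (A ^ k) y = evalSeries A y ^ k := by
  simp [evalSeries_eq_coeff_comp, comp_pow]

lemma evalSeries_X (y : ℝ≥0∞) : evalSeries X y = y := by
  simp [evalSeries_eq_coeff_comp, comp_X]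

lemma coeff_mul_pow_le_evalSeries (A : ℝ≥0∞⟦X⟧) (y : ℝ≥0∞) (j : ℕ) :
    coeff j A * y ^ j ≤ evalSeries A y :=
  ENNReal.le_tsum j

lemma evalSeries_le_one {A : ℝ≥0∞⟦X⟧} {y : ℝ≥0∞} (hy : y ≤ 1) :
    evalSeries A y ≤ evalSeries A 1 := by
  unfold evalSeries
  gcongr

lemma coeff_mul_le {A B : ℝ≥0∞⟦X⟧} {c : ℝ≥0∞} (hB : ∀ j, coeff j B ≤ c) (n : ℕ) :
    coeff n (A * B) ≤ evalSeries A 1 * c := by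
  rw [coeff_mul, Finset.Nat.sum_antidiagonal_eq_sum_range_succ
    (fun a b => coeff a A * coeff b B)]
  calc ∑ k ∈ Finset.range n.succ, coeff k A * coeff (n - k) B
      ≤ ∑ k ∈ Finset.range n.succ, coeff k A * c := by gcongr; exact hB _
    _ = (∑ k ∈ Finset.range n.succ, coeff k A) * c := by rw [Finset.sum_mul]
    _ ≤ evalSeries A 1 * c := by
      gcongr
      simp only [evalSeries, one_pow, mul_one]
      exact ENNReal.sum_le_tsum _

lemma evalSeries_offspringSeries (ν : Measure ℕ) (y : ℝ≥0∞) :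
    evalSeries (offspringSeries ν) y = ∫⁻ k, y ^ k ∂ν := by
  rw [lintegral_countable']
  simp [evalSeries, offspringSeries, mul_comm]

lemma evalSeries_derivative (ν : Measure ℕ) (y : ℝ≥0∞) :
    evalSeries (d⁄dX ℝ≥0∞ (offspringSeries ν)) y = ∫⁻ k, k * y ^ (k - 1) ∂ν := by
  rw [lintegral_countable', tsum_eq_zero_add' ENNReal.summable]
  simp only [evalSeries, offspringSeries, coeff_derivative, coeff_mk, Nat.cast_zero, zero_mul,
    zero_add, Nat.add_sub_cancel]
  refine tsum_congr fun k => ?_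
  push_cast
  ring

lemma evalSeries_derivative_derivative (ν : Measure ℕ) :
    evalSeries (d⁄dX ℝ≥0∞ (d⁄dX ℝ≥0∞ (offspringSeries ν))) 1 =
      ∫⁻ k, k * ((k - 1 : ℕ) : ℝ≥0∞) ∂ν := by
  rw [lintegral_countable', tsum_eq_zero_add' ENNReal.summable,
    tsum_eq_zero_add' ENNReal.summable]
  simp only [evalSeries, offspringSeries, coeff_derivative, coeff_mk, Nat.cast_zero, zero_mul,
    zero_add, Nat.add_sub_cancel, Nat.sub_self, mul_zero, one_pow, mul_one]
  refine tsum_congr fun k => ?_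
  push_cast
  ring

/-- Averaged over the offspring law this yields `G(1-ε) ≤ 1 - ε + Vε²`, since `E[ξ² - ξ] = V`. -/
lemma one_sub_pow_le {ε : ℝ} (h0 : 0 ≤ ε) (h1 : ε ≤ 1) (k : ℕ) :
    (1 - ε) ^ k ≤ 1 - k * ε + (k * k - k) * ε ^ 2 := by
  induction k with
  | zero => simp
  | succ k ih =>
    have h2 : (1 - ε) ^ (k + 1) ≤ (1 - k * ε + (k * k - k) * ε ^ 2) * (1 - ε) := by
      rw [pow_succ]
      exact mul_le_mul_of_nonneg_right ih (by linarith)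
    refine h2.trans ?_
    have h3 : 0 ≤ (k : ℝ) * k - k := by
      rcases Nat.eq_zero_or_pos k with rfl | hk
      · simp
      · have : (1 : ℝ) ≤ k := by exact_mod_cast hk
        nlinarith
    have h4 : 0 ≤ ((k : ℝ) * k - k) * ε ^ 3 := by positivity
    have h5 : 0 ≤ (k : ℝ) * ε ^ 2 := by positivity
    push_cast
    nlinarith

variable {ν : Measure ℕ}

lemma IsCriticalOffspring.evalSeries_derivative_derivative_lt_top (hν : IsCriticalOffspring ν) :
    evalSeries (d⁄dX ℝ≥0∞ (d⁄dX ℝ≥0∞ (offspringSeries ν))) 1 < ∞ := by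
  rw [evalSeries_derivative_derivative]
  refine lt_of_le_of_lt (lintegral_mono fun k => ?_) hν.memLp_two.integrable_sq.lintegral_lt_top
  rw [← Nat.cast_pow, ENNReal.ofReal_natCast, sq, Nat.cast_mul]
  gcongr
  omega

variable [IsProbabilityMeasure ν]

lemma IsCriticalOffspring.evalSeries_derivative_one (hν : IsCriticalOffspring ν) :
    evalSeries (d⁄dX ℝ≥0∞ (offspringSeries ν)) 1 = 1 := by
  rw [evalSeries_derivative]
  have h := ofReal_integral_eq_lintegral_ofReal hν.integrable
    (Eventually.of_forall fun k => Nat.cast_nonneg k)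
  rw [hν.mean_eq_one, ENNReal.ofReal_one] at h
  refine (lintegral_congr fun k => ?_).trans h.symm
  simp

/-- A point below `1` at which the offspring series is close to the diagonal while its derivative is
bounded away from `1`. -/
lemma IsCriticalOffspring.exists_eval_point (hν : IsCriticalOffspring ν) :
    ∃ y κ ρ : ℝ, 0 < y ∧ y ≤ 1 ∧ 1 ≤ κ ∧ 0 ≤ ρ ∧ ρ * κ < 1 ∧
      evalSeries (offspringSeries ν) (ENNReal.ofReal y) ≤ ENNReal.ofReal (κ * y) ∧
      evalSeries (d⁄dX ℝ≥0∞ (offspringSeries ν)) (ENNReal.ofReal y) ≤ ENNReal.ofReal ρ := by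
  obtain ⟨k₀, hk₀, hνk₀⟩ := hν.exists_two_le
  set V := Var[fun k : ℕ => (k : ℝ); ν] with hV
  have hVpos : 0 < V := hν.variance_pos
  have hp : 0 < ν.real {k₀} := ENNReal.toReal_pos hνk₀ (measure_ne_top _ _)
  set a : ℝ := ν.real {k₀} * k₀ with ha
  have hapos : 0 < a := mul_pos hp (by exact_mod_cast (by omega : 0 < k₀))
  -- The loss `1 - G'(1-ε) ≥ aε` is linear while `G(y)/y - 1 ≤ 2Vε²` is quadratic; this `ε` makes
  -- the linear term dominate.
  set ε : ℝ := min (1 / 2) (a / (4 * V)) with hε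
  have hε0 : 0 < ε := lt_min (by norm_num) (by positivity)
  have hε1 : ε ≤ 1 / 2 := min_le_left _ _
  have hε2 : 4 * V * ε ≤ a := by
    have : ε ≤ a / (4 * V) := min_le_right _ _
    rw [le_div_iff₀ (by positivity)] at this
    linarith
  have hy0 : 0 < 1 - ε := by linarith
  have hy1 : 1 - ε ≤ 1 := by linarith
  have hsq : Integrable (fun k : ℕ => (k : ℝ) * k) ν := by
    simpa only [sq] using hν.memLp_two.integrable_sq
  have hsqint : ∫ k : ℕ, (k : ℝ) * k ∂ν = V + 1 := by
    have := variance_eq_sub hν.memLp_two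
    rw [hν.mean_eq_one] at this
    simp only [Pi.pow_apply, sq, one_mul] at this
    linarith
  have hdint : Integrable (fun k : ℕ => (k : ℝ) * (1 - ε) ^ (k - 1)) ν := by
    refine hν.integrable.mono' (by fun_prop) (Eventually.of_forall fun k => ?_)
    rw [Real.norm_of_nonneg (by positivity)]
    exact mul_le_of_le_one_right (Nat.cast_nonneg k) (pow_le_one₀ hy0.le hy1)
  have hind : Integrable (fun k : ℕ => ({k₀} : Set ℕ).indicator (fun _ => ε * k₀) k) ν :=
    (integrable_const _).indicator (measurableSet_singleton _)
  have hd : ∫ k : ℕ, (k : ℝ) * (1 - ε) ^ (k - 1) ∂ν ≤ 1 - a * ε := by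
    have h1 : ∫ k : ℕ, (k : ℝ) * (1 - ε) ^ (k - 1) ∂ν ≤
        ∫ k : ℕ, ((k : ℝ) - ({k₀} : Set ℕ).indicator (fun _ => ε * k₀) k) ∂ν := by
      refine integral_mono hdint (hν.integrable.sub hind) fun k => ?_
      by_cases hk : k = k₀
      · subst hk
        simp only [Set.indicator_of_mem (Set.mem_singleton k)]
        have : (1 - ε) ^ (k - 1) ≤ 1 - ε := by
          calc (1 - ε) ^ (k - 1) ≤ (1 - ε) ^ 1 := pow_le_pow_of_le_one hy0.le hy1 (by omega)
            _ = 1 - ε := pow_one _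
        calc (k : ℝ) * (1 - ε) ^ (k - 1) ≤ k * (1 - ε) := by gcongr
          _ = k - ε * k := by ring
      · simp only [Set.indicator_of_notMem (show k ∉ ({k₀} : Set ℕ) from hk), sub_zero]
        exact mul_le_of_le_one_right (Nat.cast_nonneg k) (pow_le_one₀ hy0.le hy1)
    refine h1.trans (le_of_eq ?_)
    rw [integral_sub hν.integrable hind, hν.mean_eq_one,
      integral_indicator_const _ (measurableSet_singleton _), smul_eq_mul, ha]
    ring
  have hd0 : 0 ≤ ∫ k : ℕ, (k : ℝ) * (1 - ε) ^ (k - 1) ∂ν :=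
    integral_nonneg fun k => by positivity
  have hgint : Integrable (fun k : ℕ => (1 - ε) ^ k) ν := by
    refine (integrable_const (1 : ℝ)).mono' (by fun_prop) (Eventually.of_forall fun k => ?_)
    rw [Real.norm_of_nonneg (by positivity)]
    exact pow_le_one₀ hy0.le hy1
  have hg : ∫ k : ℕ, (1 - ε) ^ k ∂ν ≤ 1 - ε + V * ε ^ 2 := by
    have hi1 : Integrable (fun k : ℕ => 1 - (k : ℝ) * ε) ν :=
      (integrable_const _).sub (hν.integrable.mul_const _)
    have hi2 : Integrable (fun k : ℕ => ((k : ℝ) * k - k) * ε ^ 2) ν :=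
      (hsq.sub hν.integrable).mul_const _
    refine (integral_mono hgint (hi1.add hi2)
      fun k => one_sub_pow_le hε0.le (by linarith) k).trans (le_of_eq ?_)
    rw [integral_add' hi1 hi2, integral_sub (integrable_const _) (hν.integrable.mul_const _),
      integral_mul_const, integral_mul_const, integral_sub hsq hν.integrable, hsqint,
      hν.mean_eq_one]
    simp
  refine ⟨1 - ε, 1 + 2 * V * ε ^ 2, 1 - a * ε, hy0, hy1, ?_, hd0.trans hd, ?_, ?_, ?_⟩
  · have : 0 ≤ 2 * V * ε ^ 2 := by positivity
    linarith
  · have h1 : 0 < a * ε := by positivity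
    have h2 : 0 < a * ε * (2 * V * ε ^ 2) := by positivity
    nlinarith
  · rw [evalSeries_offspringSeries]
    simp only [← ENNReal.ofReal_pow hy0.le]
    rw [← ofReal_integral_eq_lintegral_ofReal hgint
      (Eventually.of_forall fun k => by positivity)]
    refine ENNReal.ofReal_le_ofReal (hg.trans ?_)
    have : 0 ≤ V * ε ^ 2 * (1 / 2 - ε) := by
      have : 0 ≤ 1 / 2 - ε := by linarith
      positivity
    nlinarith
  · rw [evalSeries_derivative]
    have : ∀ k : ℕ, (k : ℝ≥0∞) * ENNReal.ofReal (1 - ε) ^ (k - 1) =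
        ENNReal.ofReal (k * (1 - ε) ^ (k - 1)) := fun k => by
      rw [ENNReal.ofReal_mul (Nat.cast_nonneg k), ENNReal.ofReal_natCast,
        ENNReal.ofReal_pow hy0.le]
    simp only [this]
    rw [← ofReal_integral_eq_lintegral_ofReal hdint
      (Eventually.of_forall fun k => by positivity)]
    exact ENNReal.ofReal_le_ofReal hd

/-- Because `√n ≤ n ≤ 2(s+1)` and `(s+1) q^s` is bounded. -/
lemma exists_pow_le_div_sqrt {q : ℝ} (hq0 : 0 ≤ q) (hq1 : q < 1) :
    ∃ K : ℝ, 0 < K ∧ ∀ s n : ℕ, 1 ≤ n → n ≤ 2 * (s + 1) → q ^ s ≤ K / √n := by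
  have h1 := (tendsto_self_mul_const_pow_of_lt_one hq0 hq1).add
    (tendsto_pow_atTop_nhds_zero_of_lt_one hq0 hq1)
  obtain ⟨K, hK⟩ := h1.bddAbove_range
  refine ⟨2 * max K 1, by positivity, fun s n hn hns => ?_⟩
  have hn1 : (1 : ℝ) ≤ n := by exact_mod_cast hn
  have hns' : (n : ℝ) ≤ 2 * (s + 1) := by exact_mod_cast hns
  have hsq : √(n : ℝ) ≤ n := by
    rw [Real.sqrt_le_left (by positivity)]
    nlinarith
  have hKs : (s : ℝ) * q ^ s + q ^ s ≤ K := hK ⟨s, rfl⟩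
  have hqs : 0 ≤ q ^ s := pow_nonneg hq0 s
  rw [le_div_iff₀ (Real.sqrt_pos.mpr (by linarith))]
  calc q ^ s * √n ≤ q ^ s * (2 * (s + 1)) := by gcongr; linarith
    _ = 2 * (s * q ^ s + q ^ s) := by ring
    _ ≤ 2 * max K 1 := by gcongr; exact hKs.trans (le_max_left _ _)

/-- The expected number of pairs on the event that the tree has `n` vertices. -/
lemma IsCriticalOffspring.exists_coeff_numPairs_le (hν : IsCriticalOffspring ν) :
    ∃ K : ℝ, 0 < K ∧ ∀ l m n : ℕ, 1 ≤ n →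
      coeff n (sizeSeries ν (numPairs l m)) ≤ ENNReal.ofReal (K / √n) := by
  obtain ⟨C₁, hC₁, hatom⟩ := hν.exists_coeff_pow_le
  obtain ⟨y, κ, ρ, hy0, hy1, hκ, hρ, hρκ, hG, hD⟩ := hν.exists_eval_point
  obtain ⟨K₁, hK₁, hpow⟩ := exists_pow_le_div_sqrt (mul_nonneg hρ (by linarith)) hρκ
  set b := max 1 (evalSeries (d⁄dX ℝ≥0∞ (d⁄dX ℝ≥0∞ (offspringSeries ν))) 1) with hb
  have hbtop : b ≠ ∞ :=
    (max_lt ENNReal.one_lt_top hν.evalSeries_derivative_derivative_lt_top).ne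
  have hb1 : 1 ≤ b.toReal := by
    rw [← ENNReal.toReal_one]
    exact ENNReal.toReal_mono hbtop (le_max_left _ _)
  refine ⟨b.toReal * (C₁ * √2 + K₁), by positivity, fun l m n hn => ?_⟩
  have hnpos : (0 : ℝ) < n := by exact_mod_cast hn
  obtain ⟨A, r, s, hrs, hA, hcoeff⟩ := coeff_sizeSeries_numPairs ν l m
  have hA1 : evalSeries A 1 ≤ b := by
    rcases hA with rfl | rfl
    · rw [evalSeries_X]
      exact le_max_left _ _
    · rw [evalSeries_mul, evalSeries_pow, evalSeries_X, one_pow, one_mul]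
      exact le_max_right _ _
  have hfin : ∀ x : ℝ, x ≤ (C₁ * √2 + K₁) / √n →
      b * ENNReal.ofReal x ≤ ENNReal.ofReal (b.toReal * (C₁ * √2 + K₁) / √n) := by
    intro x hx
    rw [mul_div_assoc, ENNReal.ofReal_mul ENNReal.toReal_nonneg, ENNReal.ofReal_toReal hbtop]
    gcongr
  rw [hcoeff]
  split_ifs with hr
  swap
  · exact zero_le
  set M := n - r with hM
  rcases le_or_gt (2 * r) n with h2r | h2r
  -- Here `M ≥ n/2`: the atom bound for `G^M` is convolved with a series of mass at most `b`, as
  -- `G'(1) = 1`.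
  · have hM1 : 1 ≤ M := by omega
    have hMpos : (0 : ℝ) < M := by exact_mod_cast hM1
    have h1 : ∀ j, coeff j (offspringSeries ν ^ M) ≤ ENNReal.ofReal (C₁ / √M) := by
      intro j
      rw [coeff_offspringSeries_pow, ← ENNReal.ofReal_coe_nnreal]
      exact ENNReal.ofReal_le_ofReal (hatom M j hM1)
    refine (coeff_mul_le h1 M).trans ?_
    rw [evalSeries_mul, evalSeries_pow, hν.evalSeries_derivative_one, one_pow, mul_one]
    refine (mul_le_mul_left hA1 _).trans (hfin _ ?_)
    have h2 : √(n : ℝ) ≤ √2 * √M := by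
      rw [← Real.sqrt_mul (by norm_num)]
      refine Real.sqrt_le_sqrt ?_
      exact_mod_cast (by omega : n ≤ 2 * M)
    rw [div_le_div_iff₀ (by positivity) (by positivity)]
    calc C₁ * √n ≤ C₁ * (√2 * √M) := by gcongr
      _ = C₁ * √2 * √M := by ring
      _ ≤ (C₁ * √2 + K₁) * √M := by gcongr; linarith
  -- Here `M < r ≤ s + 1`, so `κ^M ≤ κ^s`, and the coefficient is at most `b (ρκ)^s`; also `n < 2r ≤
  -- 2(s+1)`.
  · have hMs : M ≤ s := by omega
    set Y := ENNReal.ofReal y with hY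
    have hY0 : Y ^ M ≠ 0 := pow_ne_zero _ (by simpa [hY] using hy0)
    have hYtop : Y ^ M ≠ ∞ := ENNReal.pow_ne_top ENNReal.ofReal_ne_top
    have hY1 : Y ≤ 1 := by
      rw [hY, ← ENNReal.ofReal_one]
      exact ENNReal.ofReal_le_ofReal hy1
    have h1 := coeff_mul_pow_le_evalSeries
      (A * d⁄dX ℝ≥0∞ (offspringSeries ν) ^ s * offspringSeries ν ^ M) Y M
    rw [evalSeries_mul, evalSeries_mul, evalSeries_pow, evalSeries_pow] at h1
    have h2 : evalSeries A Y * evalSeries (d⁄dX ℝ≥0∞ (offspringSeries ν)) Y ^ s *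
        evalSeries (offspringSeries ν) Y ^ M ≤ b * ENNReal.ofReal ((ρ * κ) ^ s) * Y ^ M := by
      calc _ ≤ b * ENNReal.ofReal ρ ^ s * ENNReal.ofReal (κ * y) ^ M := by
            gcongr
            exact (evalSeries_le_one hY1).trans hA1
        _ = b * ENNReal.ofReal (ρ ^ s * κ ^ M) * Y ^ M := by
            rw [ENNReal.ofReal_mul (by linarith), ENNReal.ofReal_mul (by positivity), mul_pow,
              ENNReal.ofReal_pow hρ, ENNReal.ofReal_pow (by linarith)]
            ring
        _ ≤ b * ENNReal.ofReal ((ρ * κ) ^ s) * Y ^ M := by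
            rw [mul_pow]
            gcongr
    refine ((ENNReal.mul_le_mul_iff_left hY0 hYtop).mp (h1.trans h2)).trans (hfin _ ?_)
    refine (hpow s n hn (by omega)).trans ?_
    gcongr
    have : 0 ≤ C₁ * √2 := by positivity
    linarith

end GaltonWatson

/-! ### Conclusion: quotient of the two estimates -/

theorem theorem1p5 (ν : Measure ℕ) [IsProbabilityMeasure ν]
    (hν : GaltonWatson.IsCriticalOffspring ν) :
    ∃ C : ℝ≥0, 0 < C ∧ ∀ ℓ m n : ℕ, 1 ≤ n →
      GaltonWatson.gwMeasure ν (GaltonWatson.sizeEvent n) ≠ 0 →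
      ∫⁻ ξ, (GaltonWatson.pairCount ℓ m (GaltonWatson.familyTree ξ) : ℝ≥0∞)
        ∂(GaltonWatson.condGWMeasure ν n) ≤ (C : ℝ≥0∞) * (n : ℝ≥0∞) := by
  obtain ⟨K, hK, hupper⟩ := hν.exists_coeff_numPairs_le
  obtain ⟨c, hc, hlower⟩ := hν.exists_le_coeff_pow
  refine ⟨(K / c).toNNReal, Real.toNNReal_pos.mpr (by positivity), fun ℓ m n hn hP => ?_⟩
  simp only [GaltonWatson.pairCount_eq_numPairs]
  rw [GaltonWatson.condGWMeasure, ProbabilityTheory.cond, lintegral_smul_measure, smul_eq_mul,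
    ← GaltonWatson.coeff_sizeSeries]
  have hsize := GaltonWatson.natCast_mul_gwMeasure_sizeEvent ν n
  set P := GaltonWatson.gwMeasure ν (GaltonWatson.sizeEvent n) with hPdef
  have hPtop : P ≠ ∞ := measure_ne_top _ _
  have hcoeff : ENNReal.ofReal (c / √n) ≤ n * P := by
    obtain ⟨k, rfl⟩ : ∃ k, n = k + 1 := ⟨n - 1, by omega⟩
    rw [PowerSeries.coeff_succ_X_mul, GaltonWatson.coeff_offspringSeries_pow] at hsize
    rw [hsize, ← ENNReal.ofReal_coe_nnreal]
    refine ENNReal.ofReal_le_ofReal ?_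
    rw [div_le_iff₀' (Real.sqrt_pos.mpr (by positivity))]
    refine hlower k fun h0 => ?_
    -- A vanishing coefficient would make the conditioning event null.
    rw [h0, ENNReal.coe_zero] at hsize
    simp [hP] at hsize
  have h1 : ENNReal.ofReal (K / √n) ≤ ENNReal.ofReal (K / c) * (n * P) := by
    refine le_trans (le_of_eq ?_) (mul_le_mul_right hcoeff _)
    rw [← ENNReal.ofReal_mul (by positivity)]
    congr 1
    field_simp
  calc P⁻¹ * PowerSeries.coeff n (GaltonWatson.sizeSeries ν (GaltonWatson.numPairs ℓ m))
      ≤ P⁻¹ * (ENNReal.ofReal (K / c) * (n * P)) := by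
        gcongr
        exact (hupper ℓ m n hn).trans h1
    _ = (P⁻¹ * P) * (ENNReal.ofReal (K / c) * n) := by ring
    _ = ENNReal.ofReal (K / c) * n := by rw [ENNReal.inv_mul_cancel hP hPtop, one_mul]
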